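/- For positive integers $k$ and nonnegative integers $n$, let $c\phi_k(n)$ be the number of $k$-colored generalized Frobenius partitions of $n$. These are defined as follows. Take $k$ copies $a_1,\dots,a_k$ (colors $1,\dots,k$) of each nonnegative integer $a$, ordered by $0_1\prec 0_2\prec\cdots\prec 0_k\prec 1_1\prec 1_2\prec\cdots\prec 1_k\prec 2_1\prec\cdots$. A $k$-colored generalized Frobenius partition of $n$ is a two-row array $\begin{pmatrix} x_1, x_2, \dots, x_r\\ y_1, y_2,\dots, y_r\end{pmatrix}$ ($r\ge 0$) of such colored integers with $x_r\prec x_{r-1}\prec\cdots\prec x_1$ and $y_r\prec y_{r-1}\prec\cdots\prec y_1$ and with $n=r+\sum_{i=1}^r (|x_i|+|y_i|)$, where $|x|$ denotes the integer underlying the colored integer $x$. Theorem. For every integer $n\ge 0$ we have \begin{align*} c\phi_9(9n+3)&\equiv 0 \pmod{3^2},\\ c\phi_9(9n+6)&\equiv 0 \pmod{3^3},\\ c\phi_9(27n+15)&\equiv 0 \pmod{3^5},\\ c\phi_9(27n+24)&\equiv 0 \pmod{3^7},\\ c\phi_9(81n+51)&\equiv 0 \pmod{3^8},\\ c\phi_9(81n+78)&\equiv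 0 \pmod{3^9},\\ c\phi_9(243n+132)&\equiv 0 \pmod{3^{10}},\\ c\phi_9(243n+213)&\equiv 0 \pmod{3^{12}},\\ c\phi_9(729n+456)&\equiv 0 \pmod{3^{13}},\\ c\phi_9(729n+699)&\equiv 0 \pmod{3^{14}}. \end{align*} -/

import Mathlib

/-- A nonnegative integer `a` with a color in `{1, ..., k}`. The colors are indexed by `Fin k`, and
the order is lexicographic, value first and then color:
`0_1 < 0_2 < ... < 0_k < 1_1 < ... < 1_k < 2_1 < ...`. -/
abbrev ColoredNat (k : ℕ) : Type := ℕ ×ₗ Fin k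

/-- The integer underlying a colored integer. -/
def ColoredNat.value {k : ℕ} (a : ColoredNat k) : ℕ := (ofLex a).1

/-- A `k`-colored generalized Frobenius partition: a two-row array of `k`-colored nonnegative
integers with rows of the same length, each row strictly decreasing. -/
@[ext]
structure GenFrobeniusPartition (k : ℕ) where
  /-- the top row `a_1, ..., a_r` -/
  top : List (ColoredNat k)
  /-- the bottom row `b_1, ..., b_r` -/
  bottom : List (ColoredNat k)
  top_decreasing : top.Pairwise (fun x y => y < x)
  bottom_decreasing : bottom.Pairwise (fun x y => y < x)
  length_eq : top.length = bottom.length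

/-- The number being partitioned, `r + ∑ (a_i + b_i)`. -/
def GenFrobeniusPartition.size {k : ℕ} (P : GenFrobeniusPartition k) : ℕ :=
  P.top.length + ((P.top.map ColoredNat.value).sum + (P.bottom.map ColoredNat.value).sum)

/-- `cphi k n` is the number of `k`-colored generalized Frobenius partitions of `n`. -/
noncomputable def cphi (k n : ℕ) : ℕ :=
  Nat.card {P : GenFrobeniusPartition k // P.size = n}

/-- There are only finitely many `k`-colored generalized Frobenius partitions of `n`, so that
`cphi k n` is a true count. -/
theorem GenFrobeniusPartition.finite_size_eq (k n : ℕ) :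
    Finite {P : GenFrobeniusPartition k // P.size = n} := by
  have hS : {l : List (Fin (n + 1) × Fin k) | l.length ≤ n}.Finite :=
    List.finite_length_le _ n
  have key : ∀ l : List (ColoredNat k), l.length ≤ n → (l.map ColoredNat.value).sum ≤ n →
      l ∈ (fun l : List (Fin (n + 1) × Fin k) =>
        l.map (fun x => (toLex ((x.1 : ℕ), x.2) : ColoredNat k))) '' {l | l.length ≤ n} := by
    intro l hl hs
    refine ⟨l.map (fun a => (Fin.ofNat (n + 1) a.value, (ofLex a).2)), by simpa using hl, ?_⟩
    simp only [List.map_map]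
    conv_rhs => rw [← List.map_id l]
    refine List.map_congr_left fun a ha => ?_
    have h1 : a.value ≤ n := (List.single_le_sum (by simp) _ (List.mem_map_of_mem ha)).trans hs
    simp only [Function.comp, id, Fin.val_ofNat, Nat.mod_eq_of_lt (Nat.lt_succ_of_le h1)]
    rfl
  have hF := hS.image (fun l : List (Fin (n + 1) × Fin k) =>
    l.map (fun x => (toLex ((x.1 : ℕ), x.2) : ColoredNat k)))
  have hfin := (hF.prod hF).preimage (f := fun P : GenFrobeniusPartition k => (P.top, P.bottom))
    (fun P _ Q _ h => GenFrobeniusPartition.ext (congrArg Prod.fst h) (congrArg Prod.snd h))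
  refine (hfin.subset fun P hP => ?_).to_subtype
  have h : P.size = n := hP
  have hl := P.length_eq
  unfold GenFrobeniusPartition.size at h
  exact ⟨key P.top (by omega) (by omega), key P.bottom (by omega) (by omega)⟩

/-! Write E_m = ∏ (1 - q^(mn)), let V denote q ↦ q³, and let P be the generating function of cφ_9. A
Frobenius partition is a pair of equinumerous sets of colored integers, so by the Jacobi triple
product E_1^9 P is the constant term in z of θ^9, where θ = ∑ z^m q^(m(m+1)/2).

That constant term does not change under z ↦ ωz with ω a primitive cube root of unity. The cubes of
the three twists of θ have the form A + B + D, A + ω²B + ωD, A + ωB + ω²D (`theta_cubed`), and the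
sum of their cubes is 3 times their product plus 27ABD. Both products are again theta functions, now
in z³. This yields E_1^9 P = b³ V(a) + 81 a q w³, where a, b = E_1³/E_3 and c = 3 q^(1/3) w, w =
E_3³/E_1, are the cubic theta functions of the Borweins (`mul_genFun_cphi_nine`,
`exists_integral_parametrization`).

Put τ = w/a and s = q V(τ). The Borwein relations become a = V(a)(1 + 6s), b = V(a)(1 - 3s) and the
modular equation q τ³ = s(1 + 3s + 9s²)/(1 + 6s)³. Selecting every third coefficient of V(c)·f(s)
gives c τ^r times a polynomial in q τ³ (`trisect_evalList`), hence for suitable c a series of the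
same shape. Modulo 3^14 the factors 1 - 3s and 1 + 6s have polynomial inverses, so each trisection
is a finite computation with coefficient lists (`trisect_eq_chainStep`). Following the progressions
3n, 9n+6, 27n+24, 81n+51, 243n+213, the congruences are read off from the divisibility of every
third entry of a list. -/

open PowerSeries Filter Topology Finset
open scoped PowerSeries.WithPiTopology LaurentPolynomial

/-! ### X-adic summability of families of power series. -/

section Summability

variable {R : Type*} [CommRing R]

/-- A family of power series is `X`-adically null if it tends to `0` along the cofinite filter. -/
def XAdicNull {ι : Type*} (F : ι → R⟦X⟧) : Prop :=
  ∀ N : ℕ, {i | ¬ X ^ N ∣ F i}.Finite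

theorem XAdicNull.mul_prod {ι κ : Type*} {F : ι → R⟦X⟧} {G : κ → R⟦X⟧} (hF : XAdicNull F)
    (hG : XAdicNull G) : XAdicNull (fun p : ι × κ => F p.1 * G p.2) := by
  intro N
  refine ((hF N).prod (hG N)).subset ?_
  rintro ⟨i, j⟩ h
  exact ⟨fun h' => h (Dvd.dvd.mul_right h' _), fun h' => h (Dvd.dvd.mul_left h' _)⟩

theorem XAdicNull.mul_right {ι : Type*} {F : ι → R⟦X⟧} (hF : XAdicNull F) (G : ι → R⟦X⟧) :
    XAdicNull (fun i => F i * G i) := fun N =>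
  (hF N).subset fun _ h h' => h (Dvd.dvd.mul_right h' _)

theorem XAdicNull.comp_injective {ι κ : Type*} {F : ι → R⟦X⟧} (hF : XAdicNull F) {e : κ → ι}
    (he : Function.Injective e) : XAdicNull (fun i => F (e i)) := fun N =>
  (hF N).preimage he.injOn

variable [TopologicalSpace R]

theorem XAdicNull.summable {ι : Type*} {F : ι → R⟦X⟧} (hF : XAdicNull F) : Summable F := by
  rw [WithPiTopology.summable_iff_summable_coeff]
  intro n
  refine summable_of_hasFiniteSupport ((hF (n + 1)).subset ?_)
  intro i hi h
  exact hi (X_pow_dvd_iff.1 h n (Nat.lt_succ_self n))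

theorem X_pow_dvd_of_hasSum [DiscreteTopology R] {ι : Type*} {F : ι → R⟦X⟧} {s : R⟦X⟧} (h : HasSum F s) {N : ℕ}
    (hF : ∀ i, X ^ N ∣ F i) : X ^ N ∣ s := by
  rw [X_pow_dvd_iff]
  intro m hm
  have := (WithPiTopology.hasSum_iff_hasSum_coeff R).1 h m
  refine this.unique ?_
  convert hasSum_zero using 2 with i
  exact X_pow_dvd_iff.1 (hF i) m hm

theorem tendsto_of_X_pow_dvd_sub {F : ℕ → R⟦X⟧} {g : R⟦X⟧} (h : ∀ n, X ^ n ∣ g - F n) :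
    Tendsto F atTop (𝓝 g) := by
  rw [WithPiTopology.tendsto_iff_coeff_tendsto]
  intro d
  refine tendsto_atTop_of_eventually_const (i₀ := d + 1) fun n hn => ?_
  have := X_pow_dvd_iff.1 (h n) d (by omega)
  rw [map_sub, sub_eq_zero] at this
  exact this.symm

theorem tsum_int_eq_tsum_three [DiscreteTopology R] {F : ℤ → R⟦X⟧} (hF : XAdicNull F) :
    ∑' m, F m = ∑' k, F (3 * k) + ∑' k, F (3 * k - 1) + ∑' k, F (3 * k - 2) := by
  have hinj : ∀ j : ℤ, Function.Injective fun k : ℤ => 3 * k - j := fun j a b h => by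
    simpa using h
  have hs : ∀ j : ℤ, Summable fun k : ℤ => F (3 * k - j) := fun j =>
    (hF.comp_injective (hinj j)).summable
  have key : ∀ j : ℤ, HasSum ({m : ℤ | m % 3 = (-j) % 3}.indicator F) (∑' k, F (3 * k - j)) := by
    intro j
    have he : {m : ℤ | m % 3 = (-j) % 3} = Set.range fun k : ℤ => 3 * k - j := by
      ext m
      simp only [Set.mem_ofPred_eq, Set.mem_range]
      exact ⟨fun h => ⟨(m + j) / 3, by omega⟩, fun ⟨k, hk⟩ => by omega⟩
    rw [he, ← hasSum_subtype_iff_indicator]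
    exact (hinj j).hasSum_range_iff.2 (hs j).hasSum
  have h := ((key 0).add (key 1)).add (key 2)
  simp only [sub_zero] at h
  convert h.tsum_eq using 3 with m
  simp only [Set.indicator_apply, Set.mem_ofPred_eq]
  have : m % 3 = 0 ∨ m % 3 = 1 ∨ m % 3 = 2 := by omega
  rcases this with h | h | h <;> simp [h]

end Summability

/-! ### Triangular numbers and the terms of the theta series. -/

/-- The triangular number `m (m + 1) / 2`. -/
def tri (m : ℤ) : ℕ := (m * (m + 1) / 2).toNat

/-- For every integer m the product m(m+1) is even and nonnegative, so neither the division nor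
`toNat` loses anything. Exponent identities reduce to this linear relation. -/
theorem two_mul_tri (m : ℤ) : 2 * (tri m : ℤ) = m * (m + 1) := by
  have h1 : 0 ≤ m * (m + 1) := by
    rcases le_or_gt 0 m with h | h <;> nlinarith
  have h2 : m * (m + 1) % 2 = 0 := Int.even_iff.1 (Int.even_mul_succ_self m)
  unfold tri
  omega

theorem tri_sub_one_add (m : ℤ) : (tri (m - 1) : ℤ) + m = tri m := by
  have h1 := two_mul_tri m
  have h2 := two_mul_tri (m - 1)
  linarith

theorem tri_add_one (m : ℤ) : (tri (m + 1) : ℤ) = tri m + m + 1 := by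
  have h1 := two_mul_tri m
  have h2 := two_mul_tri (m + 1)
  linarith

theorem tri_neg_one_sub (m : ℤ) : tri (-1 - m) = tri m := by
  have h1 := two_mul_tri m
  have h2 := two_mul_tri (-1 - m)
  have : (tri (-1 - m) : ℤ) = tri m := by linarith
  exact_mod_cast this

theorem le_tri (m : ℤ) : m ≤ tri m ∧ -m - 1 ≤ tri m := by
  have h1 := two_mul_tri m
  constructor <;> nlinarith

section Theta

variable {R : Type*} [CommRing R]

/-- The general term of Ramanujan's theta function. -/
def thetaTerm {A : Type*} [CommRing A] (x y : A) (m : ℤ) : A := x ^ tri m * y ^ tri (m - 1)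

/-- The ratio of consecutive terms is x(xy)^m. Since m may be negative, the relation is cleared of
denominators by natural exponents n and k with n - k = m. -/
theorem thetaTerm_mul_left {A : Type*} [CommRing A] (x y : A) (m : ℤ) (n k : ℕ) (h : m + k = n) :
    thetaTerm x y m * (x * (x * y) ^ n) = thetaTerm x y (m + 1) * (x * y) ^ k := by
  have h1 := tri_sub_one_add m
  have h2 := tri_add_one m
  have e1 : tri m + 1 + n = tri (m + 1) + k := by omega
  have e2 : tri (m - 1) + n = tri m + k := by omega
  unfold thetaTerm
  calc _ = x ^ (tri m + 1 + n) * y ^ (tri (m - 1) + n) := by ring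
    _ = _ := by rw [e1, e2, add_sub_cancel_right]; ring

theorem thetaTerm_mul_right {A : Type*} [CommRing A] (x y : A) (m : ℤ) (n k : ℕ)
    (h : n + m + 1 = k) :
    thetaTerm x y (m + 1) * (y * (x * y) ^ n) = thetaTerm x y m * (x * y) ^ k := by
  have h1 := tri_sub_one_add m
  have h2 := tri_add_one m
  have e1 : tri (m + 1) + n = tri m + k := by omega
  have e2 : tri m + 1 + n = tri (m - 1) + k := by omega
  unfold thetaTerm
  rw [add_sub_cancel_right]
  calc _ = x ^ (tri (m + 1) + n) * y ^ (tri m + 1 + n) := by ring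
    _ = _ := by rw [e1, e2]; ring

theorem pow_dvd_thetaTerm {A : Type*} [CommRing A] (x y : A) (m : ℤ) {N : ℕ} (h1 : N ≤ tri m)
    (h2 : N ≤ tri (m - 1)) : (x * y) ^ N ∣ thetaTerm x y m := by
  rw [mul_pow]
  exact mul_dvd_mul (pow_dvd_pow _ h1) (pow_dvd_pow _ h2)

theorem xAdicNull_thetaTerm {x y : R⟦X⟧} {M : ℕ} (hM : 0 < M) (hxy : x * y = X ^ M) :
    XAdicNull (thetaTerm x y) := by
  intro N
  refine (Set.finite_Icc (-(N : ℤ) - 2) (N + 2)).subset ?_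
  intro m hm
  by_contra hc
  apply hm
  have h1 := le_tri m
  have h2 := le_tri (m - 1)
  have h3 : N ≤ tri m ∧ N ≤ tri (m - 1) := by
    rw [Set.mem_Icc] at hc
    omega
  refine dvd_trans ?_ (pow_dvd_thetaTerm x y m h3.1 h3.2)
  rw [hxy, ← pow_mul]
  exact pow_dvd_pow _ (Nat.le_mul_of_pos_left _ hM)

variable [TopologicalSpace R]

/-- Ramanujan's theta function `∑ x ^ (m (m + 1) / 2) y ^ (m (m - 1) / 2)`. -/
noncomputable def theta (x y : R⟦X⟧) : R⟦X⟧ := ∑' m, thetaTerm x y m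

end Theta

/-! ### Gaussian binomials and the finite triple product. -/

section FiniteTripleProduct

variable {A : Type*} [CommRing A] (p : A)

/-- The `p`-Pochhammer symbol `(1 - p) ⋯ (1 - p ^ n)`. -/
def pochhammer' (n : ℕ) : A := ∏ j ∈ range n, (1 - p ^ (j + 1))

/-- The Gaussian binomial coefficient `[k + l, k]`. -/
def gaussBinom : ℕ → ℕ → A
  | 0, _ => 1
  | _ + 1, 0 => 1
  | k + 1, l + 1 => gaussBinom k (l + 1) + p ^ (k + 1) * gaussBinom (k + 1) l

@[simp] theorem gaussBinom_zero_left (l : ℕ) : gaussBinom p 0 l = 1 := by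
  cases l <;> simp [gaussBinom]

@[simp] theorem gaussBinom_zero_right (k : ℕ) : gaussBinom p k 0 = 1 := by
  cases k <;> simp [gaussBinom]

theorem gaussBinom_succ_succ (k l : ℕ) : gaussBinom p (k + 1) (l + 1) =
    gaussBinom p k (l + 1) + p ^ (k + 1) * gaussBinom p (k + 1) l := by
  rw [gaussBinom]

theorem pochhammer'_succ (n : ℕ) :
    pochhammer' p (n + 1) = pochhammer' p n * (1 - p ^ (n + 1)) := prod_range_succ _ _

theorem gaussBinom_mul (k l : ℕ) :
    gaussBinom p k l * pochhammer' p k * pochhammer' p l = pochhammer' p (k + l) := by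
  induction k generalizing l with
  | zero => simp [pochhammer']
  | succ k ihk =>
    induction l with
    | zero => simp [pochhammer']
    | succ l ihl =>
      have h1 := ihk (l + 1)
      rw [show k + 1 + (l + 1) = (k + l + 1) + 1 by ring, pochhammer'_succ p (k + l + 1)]
      rw [show k + (l + 1) = k + l + 1 by ring] at h1
      rw [show k + 1 + l = k + l + 1 by ring] at ihl
      rw [gaussBinom_succ_succ]
      rw [pochhammer'_succ p l] at h1 ⊢
      rw [pochhammer'_succ p k] at ihl ⊢
      linear_combination (1 - p ^ (k + 1)) * h1 + p ^ (k + 1) * (1 - p ^ (l + 1)) * ihl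

variable {p}

/-- The mirror image of the defining q-Pascal rule. It follows from the quotient formula
`gaussBinom_mul` by cancelling Pochhammer symbols, which is why these must be units. -/
theorem gaussBinom_succ_succ' (hp : ∀ n, IsUnit (pochhammer' p n)) (k l : ℕ) :
    gaussBinom p (k + 1) (l + 1) =
      gaussBinom p (k + 1) l + p ^ (l + 1) * gaussBinom p k (l + 1) := by
  have h := ((hp (k + 1)).mul (hp (l + 1)))
  apply h.mul_right_cancel
  have h0 := gaussBinom_mul p (k + 1) (l + 1)
  have h1 := gaussBinom_mul p k (l + 1)
  have h2 := gaussBinom_mul p (k + 1) l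
  rw [show k + 1 + (l + 1) = (k + l + 1) + 1 by ring, pochhammer'_succ p (k + l + 1)] at h0
  rw [show k + (l + 1) = k + l + 1 by ring] at h1
  rw [show k + 1 + l = k + l + 1 by ring] at h2
  rw [pochhammer'_succ p l] at *
  rw [pochhammer'_succ p k] at *
  linear_combination h0 - (1 - p ^ (l + 1)) * h2 - p ^ (l + 1) * (1 - p ^ (k + 1)) * h1

/-- A finite form of the Jacobi triple product identity. -/
theorem prod_mul_prod_eq_sum_gaussBinom (x y : A) (hp : ∀ n, IsUnit (pochhammer' (x * y) n))
    (n n' : ℕ) :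
    (∏ j ∈ range n, (1 + x * (x * y) ^ j)) * ∏ j ∈ range n', (1 + y * (x * y) ^ j) =
      ∑ kl ∈ antidiagonal (n + n'),
        gaussBinom (x * y) kl.1 kl.2 * thetaTerm x y (kl.1 - n') := by
  induction n' with
  | zero =>
    induction n with
    | zero => simp [thetaTerm, tri]
    | succ n ih =>
      simp only [range_zero, prod_empty, mul_one, add_zero, Nat.cast_zero, sub_zero] at ih ⊢
      rw [prod_range_succ, ih]
      -- A new factor in x is absorbed by one q-Pascal rule and a new factor in y, below, by the
      -- other. Boundary indices are treated by the `if`s, as the truncated predecessor would be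
      -- wrong there.
      have hsplit : ∀ kl ∈ antidiagonal (n + 1), gaussBinom (x * y) kl.1 kl.2 =
          (if kl.2 = 0 then 0 else gaussBinom (x * y) kl.1 (kl.2 - 1)) +
          (if kl.1 = 0 then 0 else (x * y) ^ kl.2 * gaussBinom (x * y) (kl.1 - 1) kl.2) := by
        rintro ⟨k, l⟩ hkl
        rw [HasAntidiagonal.mem_antidiagonal] at hkl
        rcases k with _ | k <;> rcases l with _ | l <;> simp at hkl ⊢
        exact gaussBinom_succ_succ' hp k l
      rw [sum_congr (s₁ := antidiagonal (n + 1)) rfl fun kl hkl =>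
        (congrArg (· * thetaTerm x y kl.1) (hsplit kl hkl)).trans (add_mul _ _ _),
        sum_add_distrib, mul_add, mul_one]
      congr 1
      · rw [Nat.sum_antidiagonal_succ']
        simp
      · rw [Nat.sum_antidiagonal_succ, sum_mul]
        simp only [if_true, zero_mul, zero_add, Nat.add_eq_zero_iff, one_ne_zero, and_false,
          if_false, Nat.add_sub_cancel]
        refine sum_congr rfl ?_
        rintro ⟨k, l⟩ hkl
        rw [HasAntidiagonal.mem_antidiagonal] at hkl
        have := thetaTerm_mul_left x y k n l (by simp at hkl; omega)
        push_cast
        linear_combination gaussBinom (x * y) k l * this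
  | succ n' ih =>
    rw [prod_range_succ, ← mul_assoc, ih]
    have hsplit : ∀ kl ∈ antidiagonal (n + n' + 1), gaussBinom (x * y) kl.1 kl.2 =
        (if kl.1 = 0 then 0 else gaussBinom (x * y) (kl.1 - 1) kl.2) +
        (if kl.2 = 0 then 0 else (x * y) ^ kl.1 * gaussBinom (x * y) kl.1 (kl.2 - 1)) := by
      rintro ⟨k, l⟩ hkl
      rw [HasAntidiagonal.mem_antidiagonal] at hkl
      rcases k with _ | k <;> rcases l with _ | l <;> simp at hkl ⊢
      exact gaussBinom_succ_succ _ k l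
    rw [← add_assoc n n' 1,
      sum_congr (s₁ := antidiagonal (n + n' + 1)) rfl fun kl hkl =>
        (congrArg (· * thetaTerm x y (kl.1 - (n' + 1 : ℕ))) (hsplit kl hkl)).trans (add_mul _ _ _),
      sum_add_distrib, mul_add, mul_one]
    congr 1
    · rw [Nat.sum_antidiagonal_succ]
      simp
    · rw [Nat.sum_antidiagonal_succ', sum_mul]
      simp only [if_true, zero_mul, zero_add, Nat.add_eq_zero_iff, one_ne_zero, and_false,
        if_false, Nat.add_sub_cancel]
      refine sum_congr rfl ?_
      rintro ⟨k, l⟩ hkl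
      have := thetaTerm_mul_right x y (k - (n' + 1)) n' k (by ring)
      rw [show ((k : ℤ) - (n' + 1) + 1) = k - n' by ring] at this
      push_cast
      linear_combination gaussBinom (x * y) k l * this

theorem pow_dvd_pochhammer'_sub (p : A) {s n : ℕ} (h : s ≤ n) :
    p ^ (s + 1) ∣ pochhammer' p n - pochhammer' p s := by
  induction n, h using Nat.le_induction with
  | base => simp
  | succ n h ih =>
    rw [pochhammer'_succ]
    have : pochhammer' p n * (1 - p ^ (n + 1)) - pochhammer' p s =
      (pochhammer' p n - pochhammer' p s) - p ^ (n + 1) * pochhammer' p n := by ring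
    rw [this]
    exact dvd_sub ih (Dvd.dvd.mul_right (pow_dvd_pow _ (by omega)) _)

/-- By `gaussBinom_mul` the product is (p)_n (p)_(k+l) / ((p)_k (p)_l), and all four symbols agree
with (p)_s modulo p^(s+1). Multiplying by the unit (p)_s² avoids division. -/
theorem pow_dvd_pochhammer'_mul_gaussBinom_sub_one (hp : ∀ n, IsUnit (pochhammer' p n))
    {s n k l : ℕ} (h1 : s ≤ n) (h2 : s ≤ k) (h3 : s ≤ l) :
    p ^ (s + 1) ∣ pochhammer' p n * gaussBinom p k l - 1 := by
  have hd := fun {m} (h : s ≤ m) => pow_dvd_pochhammer'_sub p h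
  set P := pochhammer' p s with hP
  have hu : IsUnit (P * P) := (hp s).mul (hp s)
  rw [← hu.dvd_mul_right]
  have h0 := gaussBinom_mul p k l
  have e : (pochhammer' p n * gaussBinom p k l - 1) * (P * P) =
      (pochhammer' p n - P) * pochhammer' p (k + l) + P * (pochhammer' p (k + l) - P)
      - pochhammer' p n * gaussBinom p k l * ((pochhammer' p k - P) * pochhammer' p l
        + P * (pochhammer' p l - P)) := by
    linear_combination pochhammer' p n * h0
  rw [e]
  refine dvd_sub (dvd_add ?_ ?_) (Dvd.dvd.mul_left (dvd_add ?_ ?_) _)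
  · exact Dvd.dvd.mul_right (hd h1) _
  · exact Dvd.dvd.mul_left (hd (by omega)) _
  · exact Dvd.dvd.mul_right (hd h2) _
  · exact Dvd.dvd.mul_left (hd h3) _

end FiniteTripleProduct

/-! ### The Jacobi triple product as a limit. -/

section TripleProduct

variable {R : Type*} [CommRing R]

theorem isUnit_pochhammer' {M : ℕ} (hM : 0 < M) (n : ℕ) :
    IsUnit (pochhammer' (X ^ M : R⟦X⟧) n) := by
  rw [PowerSeries.isUnit_iff_constantCoeff]
  simp [pochhammer', hM.ne']

variable [TopologicalSpace R]

theorem hasSum_thetaTerm {x y : R⟦X⟧} {M : ℕ} (hM : 0 < M) (hxy : x * y = X ^ M) :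
    HasSum (thetaTerm x y) (theta x y) := (xAdicNull_thetaTerm hM hxy).summable.hasSum

/-- The Jacobi triple product identity. -/
theorem tendsto_theta [DiscreteTopology R] {x y : R⟦X⟧} {M : ℕ} (hM : 0 < M) (hxy : x * y = X ^ M) :
    Tendsto (fun n => pochhammer' (X ^ M) n * ((∏ j ∈ range n, (1 + x * (X ^ M) ^ j)) *
      ∏ j ∈ range n, (1 + y * (X ^ M) ^ j))) atTop (𝓝 (theta x y)) := by
  refine tendsto_of_X_pow_dvd_sub fun n => ?_
  set c : ℤ → R⟦X⟧ := fun m => if m ∈ Icc (-(n : ℤ)) n then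
    pochhammer' (X ^ M) n * gaussBinom (X ^ M) (n + m).toNat (n - m).toNat else 0 with hc
  have hfin : pochhammer' (X ^ M) n * ((∏ j ∈ range n, (1 + x * (X ^ M) ^ j)) *
      ∏ j ∈ range n, (1 + y * (X ^ M) ^ j)) = ∑ m ∈ Icc (-(n : ℤ)) n, c m * thetaTerm x y m := by
    have h := prod_mul_prod_eq_sum_gaussBinom x y (by rw [hxy]; exact isUnit_pochhammer' hM) n n
    rw [hxy] at h
    rw [h, mul_sum]
    refine sum_nbij' (fun kl => (kl.1 : ℤ) - n) (fun m => ((n + m).toNat, (n - m).toNat))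
      ?_ ?_ ?_ ?_ ?_
    · rintro ⟨k, l⟩ h
      simp at h ⊢
      omega
    · intro m h
      simp at h ⊢
      omega
    · rintro ⟨k, l⟩ h
      simp at h ⊢
      omega
    · intro m h
      simp at h ⊢
      omega
    · rintro ⟨k, l⟩ h
      simp only [HasAntidiagonal.mem_antidiagonal] at h
      have h1 : ((k : ℤ) - n) ∈ Icc (-(n : ℤ)) n := by simp; omega
      have h2 : ((n : ℤ) + (k - n)).toNat = k := by omega
      have h3 : ((n : ℤ) - (k - n)).toNat = l := by omega
      simp only [hc, if_pos h1, h2, h3]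
      ring
  have hs : HasSum (fun m => c m * thetaTerm x y m) (∑ m ∈ Icc (-(n : ℤ)) n, c m * thetaTerm x y m) :=
    hasSum_sum_of_ne_finset_zero fun m hm => by simp only [hc, if_neg hm, zero_mul]
  rw [hfin]
  refine X_pow_dvd_of_hasSum ((hasSum_thetaTerm hM hxy).sub hs) fun m => ?_
  have t1 := le_tri m
  have t2 := le_tri (m - 1)
  have hd := fun {N} (h : N ≤ tri m) h' => pow_dvd_thetaTerm x y m (N := N) h h'
  rw [hxy] at hd
  have hX : (X ^ n : R⟦X⟧) ∣ (X ^ M) ^ n := by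
    rw [← pow_mul]
    exact pow_dvd_pow _ (Nat.le_mul_of_pos_left _ hM)
  refine dvd_trans hX ?_
  by_cases hm : m ∈ Icc (-(n : ℤ)) n
  · simp only [hc, if_pos hm]
    rw [mem_Icc] at hm
    -- The coefficient at m is 1 up to order n - |m| + 1 in X^M, and the theta term itself has order
    -- at least |m| - 1; together they reach n.
    have h1 := pow_dvd_pochhammer'_mul_gaussBinom_sub_one (isUnit_pochhammer' (R := R) hM)
      (s := n - m.natAbs) (n := n) (k := (n + m).toNat) (l := (n - m).toNat)
      (by omega) (by omega) (by omega)
    have h2 := hd (N := m.natAbs - 1) (by omega) (by omega)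
    have h3 := mul_dvd_mul h1 h2
    rw [← pow_add] at h3
    refine (dvd_trans (pow_dvd_pow _ (n := n - m.natAbs + 1 + (m.natAbs - 1)) (by omega)) ?_)
    rw [← dvd_neg]
    convert h3 using 1
    ring
  · simp only [hc, if_neg hm, zero_mul, sub_zero]
    rw [mem_Icc] at hm
    exact hd (by omega) (by omega)

end TripleProduct

/-! ### Euler's product as a power series. -/

section Euler

variable (R : Type*) [CommRing R]

/-- Euler's product `∏ (1 - X ^ (M n))`. -/
noncomputable def eulerSeries (M : ℕ) (hM : M ≠ 0) : R⟦X⟧ := expand M hM (pentagonalSeries R)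

variable {R}

/-- Each output coefficient depends on a single input coefficient. This covers `expand`, `map` and
`constTerm` at once. -/
theorem continuous_of_coeff_eq {S : Type*} [CommRing S] [TopologicalSpace R] [DiscreteTopology R]
    [TopologicalSpace S] {F : R⟦X⟧ → S⟦X⟧} (i : ℕ → ℕ) (g : ℕ → R → S)
    (h : ∀ f n, coeff n (F f) = g n (coeff (i n) f)) : Continuous F := by
  rw [continuous_iff_continuousAt]
  intro f
  rw [ContinuousAt, WithPiTopology.tendsto_iff_coeff_tendsto]
  intro d
  simp only [h]
  exact ((continuous_of_discreteTopology (f := g d)).comp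
    (WithPiTopology.continuous_coeff R (i d))).continuousAt

theorem continuous_expand [TopologicalSpace R] [DiscreteTopology R] (M : ℕ) (hM : M ≠ 0) :
    Continuous (expand M hM : R⟦X⟧ → R⟦X⟧) :=
  continuous_of_coeff_eq (fun n => n / M) (fun n r => if M ∣ n then r else 0)
    fun f _ => coeff_expand M hM f

theorem tendsto_pochhammer' [TopologicalSpace R] [DiscreteTopology R] (M : ℕ) (hM : M ≠ 0) :
    Tendsto (pochhammer' (X ^ M : R⟦X⟧)) atTop (𝓝 (eulerSeries R M hM)) := by
  have h := ((continuous_expand (R := R) M hM).tendsto _).comp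
    (WithPiTopology.hasProd_one_sub_X_pow R).tendsto_prod_nat
  convert h using 1
  · funext n
    simp [pochhammer', Function.comp, map_prod]
  · rfl

theorem expand_eulerSeries (M N : ℕ) (hM : M ≠ 0) (hN : N ≠ 0) :
    expand M hM (eulerSeries R N hN) = eulerSeries R (M * N) (mul_ne_zero hM hN) := by
  rw [eulerSeries, eulerSeries, expand_mul]

theorem constantCoeff_eulerSeries (M : ℕ) (hM : M ≠ 0) :
    constantCoeff (eulerSeries R M hM) = 1 := by
  rw [eulerSeries, constantCoeff_expand]
  have := coeff_pentagonalSeries_pentagonal R 0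
  simpa [pentagonal] using this

theorem map_eulerSeries {S : Type*} [CommRing S] (f : R →+* S) (M : ℕ) (hM : M ≠ 0) :
    map f (eulerSeries R M hM) = eulerSeries S M hM := by
  rw [eulerSeries, map_expand, eulerSeries]
  congr 1
  ext n
  rw [coeff_map]
  by_cases h : n ∈ Set.range pentagonal
  · obtain ⟨k, rfl⟩ := h
    simp
  · rw [coeff_pentagonalSeries_eq_zero R h, coeff_pentagonalSeries_eq_zero S h, map_zero]

end Euler

/-! ### Product evaluations of special theta functions. -/

section ThetaProducts

variable {R : Type*} [CommRing R] [TopologicalSpace R] [DiscreteTopology R]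

theorem prod_range_three_mul {A : Type*} [CommMonoid A] (F : ℕ → A) (n : ℕ) :
    ∏ j ∈ range (3 * n), F j = ∏ j ∈ range n, (F (3 * j) * F (3 * j + 1) * F (3 * j + 2)) := by
  induction n with
  | zero => simp
  | succ n ih =>
    rw [prod_range_succ, ← ih, show 3 * (n + 1) = 3 * n + 1 + 1 + 1 by ring, prod_range_succ,
      prod_range_succ, prod_range_succ]
    simp only [mul_assoc]

theorem tendsto_three_mul {α : Type*} {l : Filter α} {F : ℕ → α} (h : Tendsto F atTop l) :
    Tendsto (fun n => F (3 * n)) atTop l :=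
  h.comp (tendsto_id.const_mul_atTop' (by norm_num))

/-- The three products on the left run over the multiples of M in the three residue classes modulo
3M, so together they form Euler's product cut off at 3n. -/
theorem theta_neg_neg (M : ℕ) (hM : M ≠ 0) :
    theta (-X ^ (2 * M)) (-X ^ M : R⟦X⟧) = eulerSeries R M hM := by
  have h3 : 0 < 3 * M := by omega
  have h := tendsto_theta (R := R) h3 (x := -X ^ (2 * M)) (y := -X ^ M) (by ring)
  refine tendsto_nhds_unique h (tendsto_three_mul (tendsto_pochhammer' M hM) |>.congr fun n => ?_)
  rw [pochhammer', pochhammer', prod_range_three_mul, ← prod_mul_distrib, ← prod_mul_distrib]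
  refine prod_congr rfl fun j _ => ?_
  ring

theorem theta_neg_neg_one (M : ℕ) (hM : M ≠ 0) : theta (-X ^ M) (-1 : R⟦X⟧) = 0 := by
  have h := tendsto_theta (R := R) (Nat.pos_of_ne_zero hM) (x := -X ^ M) (y := -1) (by ring)
  refine tendsto_nhds_unique h (tendsto_const_nhds.congr' ?_)
  filter_upwards [eventually_gt_atTop 0] with n hn
  obtain ⟨m, rfl⟩ := Nat.exists_eq_add_of_lt hn
  rw [zero_add, prod_range_succ' (fun j => 1 + (-1) * (X ^ M : R⟦X⟧) ^ j)]
  ring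

theorem theta_cube_root {ω : R} (hω : ω ^ 2 + ω + 1 = 0) :
    theta (-(C ω * X)) (-C (ω ^ 2) : R⟦X⟧) = C (1 - ω ^ 2) * eulerSeries R 3 (by norm_num) := by
  have h3 : ω ^ 3 = 1 := by linear_combination (ω - 1) * hω
  have hc : C ω ^ 2 + C ω + (1 : R⟦X⟧) = 0 := by simpa using congrArg (C (R := R)) hω
  have h := tendsto_theta (R := R) one_pos (x := -(C ω * X)) (y := -C (ω ^ 2)) (by
    rw [neg_mul_neg, mul_right_comm, ← map_mul, show ω * ω ^ 2 = 1 by rw [← h3]; ring]; simp)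
  -- The y-product starts at exponent 0. The extra factor 1 - ω²X^n, which tends to 1, shifts it to
  -- start at exponent 1 and splits off the constant 1 - ω². The factors then combine by
  -- (1-Y)(1-ωY)(1-ω²Y) = 1 - Y³.
  have hX : Tendsto (fun n => 1 - C (ω ^ 2) * (X : R⟦X⟧) ^ n) atTop (𝓝 (1 - C (ω ^ 2) * 0)) :=
    tendsto_const_nhds.sub (tendsto_const_nhds.mul
      (WithPiTopology.isTopologicallyNilpotent_of_constantCoeff_zero (by simp)))
  have h2 := h.mul hX
  rw [mul_zero, sub_zero, mul_one] at h2
  refine tendsto_nhds_unique h2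
    ((tendsto_const_nhds.mul (tendsto_pochhammer' 3 (by norm_num))).congr fun n => ?_)
  have hw : C ω ^ 3 = (1 : R⟦X⟧) := by simpa using congrArg (C (R := R)) h3
  have hshift : (∏ j ∈ range n, (1 + -C (ω ^ 2) * (X ^ 1 : R⟦X⟧) ^ j)) *
      (1 - C (ω ^ 2) * X ^ n) =
      (∏ j ∈ range n, (1 - C (ω ^ 2) * (X : R⟦X⟧) ^ (j + 1))) * C (1 - ω ^ 2) := by
    have h := (prod_range_succ (fun j => 1 - C (ω ^ 2) * (X : R⟦X⟧) ^ j) n).symm.trans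
      (prod_range_succ' _ n)
    rw [pow_zero, mul_one] at h
    rw [map_sub, map_one, ← h]
    congr 1
    exact prod_congr rfl fun j _ => by ring
  rw [mul_assoc, mul_assoc, hshift, ← mul_assoc, ← mul_assoc, mul_comm, pochhammer', pochhammer',
    ← prod_mul_distrib, ← prod_mul_distrib]
  congr 1
  refine prod_congr rfl fun j _ => ?_
  rw [map_pow, pow_one]
  set Y := (X : R⟦X⟧) ^ (j + 1) with hY
  rw [show (X ^ 3 : R⟦X⟧) ^ (j + 1) = Y ^ 3 by rw [hY]; ring,
    show -(C ω * X) * (X : R⟦X⟧) ^ j = -(C ω * Y) by rw [hY]; ring]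
  linear_combination (Y - Y ^ 2 * C ω) * hc + Y ^ 3 * hw

/-- Factor by factor this is (1+z)(1+ωz)(1+ω²z) = 1 + z³. -/
theorem theta_mul_theta_mul_theta {ω : R} (hω : ω ^ 2 + ω + 1 = 0) {x y : R⟦X⟧} {M : ℕ}
    (hM : M ≠ 0) (hxy : x * y = X ^ M) :
    theta x y * theta (C ω * x) (C ω ^ 2 * y) * theta (C ω ^ 2 * x) (C ω * y) *
      eulerSeries R (3 * M) (by omega) = eulerSeries R M hM ^ 3 * theta (x ^ 3) (y ^ 3) := by
  have h3 : ω ^ 3 = 1 := by linear_combination (ω - 1) * hω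
  have hc : C ω ^ 2 + C ω + (1 : R⟦X⟧) = 0 := by simpa using congrArg (C (R := R)) hω
  have hw : C ω ^ 3 = (1 : R⟦X⟧) := by simpa using congrArg (C (R := R)) h3
  have hM' := Nat.pos_of_ne_zero hM
  have e1 := tendsto_theta hM' hxy
  have e2 := tendsto_theta hM' (x := C ω * x) (y := C ω ^ 2 * y)
    (by linear_combination C ω ^ 3 * hxy + X ^ M * hw)
  have e3 := tendsto_theta hM' (x := C ω ^ 2 * x) (y := C ω * y)
    (by linear_combination C ω ^ 3 * hxy + X ^ M * hw)
  have e4 := tendsto_theta (M := 3 * M) (by omega) (x := x ^ 3) (y := y ^ 3)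
    (by rw [← mul_pow, hxy]; ring)
  have l := ((e1.mul e2).mul e3).mul (tendsto_pochhammer' (R := R) (3 * M) (by omega))
  have r := ((tendsto_pochhammer' (R := R) M hM).pow 3).mul e4
  refine tendsto_nhds_unique l (r.congr fun n => ?_)
  have key : ∀ z t : R⟦X⟧, 1 + z ^ 3 * t ^ 3 =
      (1 + z * t) * (1 + C ω * z * t) * (1 + C ω ^ 2 * z * t) := by
    intro z t
    linear_combination (-z * t - z ^ 2 * t ^ 2 * C ω) * hc - z ^ 3 * t ^ 3 * hw
  have hp : ∀ z : R⟦X⟧, ∏ j ∈ range n, (1 + z ^ 3 * (X ^ (3 * M)) ^ j) =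
      (∏ j ∈ range n, (1 + z * (X ^ M) ^ j)) * (∏ j ∈ range n, (1 + C ω * z * (X ^ M) ^ j)) *
        ∏ j ∈ range n, (1 + C ω ^ 2 * z * (X ^ M) ^ j) := by
    intro z
    rw [← prod_mul_distrib, ← prod_mul_distrib]
    refine prod_congr rfl fun j _ => ?_
    rw [← key, show (X ^ (3 * M) : R⟦X⟧) ^ j = ((X ^ M) ^ j) ^ 3 by ring]
  rw [hp, hp]
  ring

/-- The factors of the theta product with base X^M are sorted by exponent modulo 3 into three
products with base X^(3M). -/
theorem theta_mul_theta_mul_theta_eq {Z W : R⟦X⟧} (hZ : Z * W = 1) {M : ℕ} (hM : M ≠ 0) :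
    theta (Z * X ^ (3 * M)) W * theta (Z * X ^ (2 * M)) (W * X ^ M) *
      theta (Z * X ^ M) (W * X ^ (2 * M)) * eulerSeries R M hM =
    eulerSeries R (3 * M) (by omega) ^ 3 * theta (Z * X ^ M) W := by
  have h3 : 0 < 3 * M := by omega
  have e1 := tendsto_theta h3 (x := Z * X ^ (3 * M)) (y := W)
    (by linear_combination X ^ (3 * M) * hZ)
  have e2 := tendsto_theta h3 (x := Z * X ^ (2 * M)) (y := W * X ^ M)
    (by linear_combination X ^ (3 * M) * hZ)
  have e3 := tendsto_theta h3 (x := Z * X ^ M) (y := W * X ^ (2 * M))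
    (by linear_combination X ^ (3 * M) * hZ)
  have e4 := tendsto_theta (M := M) (by omega) (x := Z * X ^ M) (y := W)
    (by linear_combination X ^ M * hZ)
  have l := ((e1.mul e2).mul e3).mul (tendsto_three_mul (tendsto_pochhammer' (R := R) M hM))
  have r := ((tendsto_pochhammer' (R := R) (3 * M) (by omega)).pow 3).mul (tendsto_three_mul e4)
  refine tendsto_nhds_unique l (r.congr fun n => ?_)
  rw [prod_range_three_mul (fun j => 1 + Z * X ^ M * (X ^ M) ^ j),
    prod_range_three_mul (fun j => 1 + W * (X ^ M) ^ j)]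
  have h1 : ∀ j : ℕ, 1 + Z * X ^ M * (X ^ M) ^ (3 * j) = 1 + Z * X ^ M * (X ^ (3 * M)) ^ j :=
    fun j => by ring
  have h2 : ∀ j : ℕ, 1 + Z * X ^ M * (X ^ M) ^ (3 * j + 1) =
    1 + Z * X ^ (2 * M) * (X ^ (3 * M)) ^ j := fun j => by ring
  have h3 : ∀ j : ℕ, 1 + Z * X ^ M * (X ^ M) ^ (3 * j + 2) =
    1 + Z * X ^ (3 * M) * (X ^ (3 * M)) ^ j := fun j => by ring
  have h4 : ∀ j : ℕ, 1 + W * (X ^ M) ^ (3 * j) = 1 + W * (X ^ (3 * M)) ^ j := fun j => by ring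
  have h5 : ∀ j : ℕ, 1 + W * (X ^ M) ^ (3 * j + 1) = 1 + W * X ^ M * (X ^ (3 * M)) ^ j :=
    fun j => by ring
  have h6 : ∀ j : ℕ, 1 + W * (X ^ M) ^ (3 * j + 2) = 1 + W * X ^ (2 * M) * (X ^ (3 * M)) ^ j :=
    fun j => by ring
  simp only [h1, h2, h3, h4, h5, h6, prod_mul_distrib]
  ring

end ThetaProducts

/-! ### Dissections of theta and of its cube. -/

section Dissection

variable {R : Type*} [CommRing R]

theorem theta_comm [TopologicalSpace R] (x y : R⟦X⟧) : theta x y = theta y x := by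
  unfold theta
  rw [← (Equiv.neg ℤ).tsum_eq]
  refine tsum_congr fun m => ?_
  have h1 := tri_neg_one_sub m
  have h2 := tri_neg_one_sub (m - 1)
  unfold thetaTerm
  rw [Equiv.neg_apply, show -m - 1 = -1 - m by ring, h1, show -m = -1 - (m - 1) by ring, h2,
    mul_comm]

theorem XAdicNull.tsum_fiber [TopologicalSpace R] [DiscreteTopology R] {ι κ : Type*} {F : ι × κ → R⟦X⟧}
    (hF : XAdicNull F) : XAdicNull (fun i => ∑' k, F (i, k)) := by
  intro N
  refine ((hF N).image Prod.fst).subset ?_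
  intro i hi
  by_contra hc
  apply hi
  refine X_pow_dvd_of_hasSum
    ((hF.comp_injective (e := fun k => (i, k)) (Prod.mk_right_injective i)).summable.hasSum)
    fun k => ?_
  by_contra hk
  exact hc ⟨(i, k), hk, rfl⟩

/-- The generating function `∑_{a + b + c = r} p ^ (a (a + 1) / 2 + b (b + 1) / 2 + c (c + 1) / 2)`,
a two-dimensional theta function of the Borweins. -/
noncomputable def borweinTheta [TopologicalSpace R] (r : ℤ) (p : R⟦X⟧) : R⟦X⟧ :=
  ∑' ab : ℤ × ℤ, p ^ (tri ab.1 + tri ab.2 + tri (r - ab.1 - ab.2))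

theorem xAdicNull_borweinTheta (r : ℤ) {M : ℕ} (hM : 0 < M) : XAdicNull
    fun ab : ℤ × ℤ => (X ^ M : R⟦X⟧) ^ (tri ab.1 + tri ab.2 + tri (r - ab.1 - ab.2)) := by
  have h1 : XAdicNull fun a : ℤ => (X ^ M : R⟦X⟧) ^ tri a := by
    have h := (xAdicNull_thetaTerm (R := R) (x := X ^ M) (y := 1) hM (mul_one _))
    have e : thetaTerm (X ^ M : R⟦X⟧) 1 = fun a => (X ^ M) ^ tri a := by
      funext a
      simp [thetaTerm]
    rwa [e] at h
  have h2 := (h1.mul_prod h1).mul_right fun ab => (X ^ M : R⟦X⟧) ^ tri (r - ab.1 - ab.2)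
  convert h2 using 2
  rw [pow_add, pow_add]

/-- The reflection a ↦ -1 - a preserves `tri` and turns index sum r into -3 - r. -/
theorem borweinTheta_neg_two [TopologicalSpace R] (p : R⟦X⟧) : borweinTheta (-2) p = borweinTheta (-1) p := by
  unfold borweinTheta
  rw [← ((Equiv.subLeft (-1 : ℤ)).prodCongr (Equiv.subLeft (-1 : ℤ))).tsum_eq]
  refine tsum_congr fun ab => ?_
  simp only [Equiv.prodCongr_apply, Prod.map_fst, Prod.map_snd, Equiv.subLeft_apply,
    tri_neg_one_sub]
  rw [← tri_neg_one_sub (-1 - ab.1 - ab.2)]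
  congr 3
  ring

variable [TopologicalSpace R] [DiscreteTopology R]

theorem expand_borweinTheta (r : ℤ) (M N : ℕ) (hM : M ≠ 0) (hN : N ≠ 0) :
    expand M hM (borweinTheta r (X ^ N : R⟦X⟧)) = borweinTheta r (X ^ (M * N)) := by
  have h := (xAdicNull_borweinTheta (R := R) r (Nat.pos_of_ne_zero hN)).summable.hasSum.map
    (expand M hM : R⟦X⟧ →ₐ[R] R⟦X⟧) (continuous_expand M hM)
  rw [borweinTheta, ← h.tsum_eq, borweinTheta]
  refine tsum_congr fun ab => ?_
  simp [Function.comp, ← pow_mul, mul_assoc]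

theorem theta_eq_add_add {x y : R⟦X⟧} {M : ℕ} (hM : 0 < M) (hxy : x * y = X ^ M) :
    theta x y = theta (x ^ 6 * y ^ 3) (x ^ 3 * y ^ 6) + x * theta (x ^ 9 * y ^ 6) (y ^ 3) +
      y * theta (x ^ 3) (x ^ 6 * y ^ 9) := by
  have h9 : 0 < 9 * M := by omega
  have hp : (x * y) ^ 9 = X ^ (9 * M) := by rw [hxy]; ring
  have hs := fun (u v : R⟦X⟧) (h : u * v = (x * y) ^ 9) =>
    (xAdicNull_thetaTerm (x := u) (y := v) h9 (h.trans hp)).summable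
  have hn := xAdicNull_thetaTerm hM hxy
  have e := tsum_int_eq_tsum_three hn
  rw [theta, e, theta, theta, theta, ← (hs _ _ (by ring)).tsum_mul_left x,
    ← (hs _ _ (by ring)).tsum_mul_left y, add_right_comm]
  congr 1
  · congr 1
    · refine tsum_congr fun k => ?_
      have a0 := two_mul_tri (3 * k)
      have a1 := two_mul_tri (3 * k - 1)
      have a2 := two_mul_tri k
      have a3 := two_mul_tri (k - 1)
      have e1 : tri (3 * k) = 6 * tri k + 3 * tri (k - 1) := by zify; linarith
      have e2 : tri (3 * k - 1) = 3 * tri k + 6 * tri (k - 1) := by zify; linarith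
      unfold thetaTerm
      rw [e1, e2]
      ring
    · rw [← (Equiv.addRight (1 : ℤ)).tsum_eq]
      refine tsum_congr fun k => ?_
      rw [Equiv.coe_addRight, show 3 * (k + 1) - 2 = 3 * k + 1 by ring]
      have a0 := two_mul_tri (3 * k + 1)
      have a1 := two_mul_tri (3 * k + 1 - 1)
      have a2 := two_mul_tri k
      have a3 := two_mul_tri (k - 1)
      have e1 : tri (3 * k + 1) = 1 + 9 * tri k := by zify; linarith
      have e2 : tri (3 * k + 1 - 1) = 6 * tri k + 3 * tri (k - 1) := by zify; linarith
      unfold thetaTerm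
      rw [e1, e2]
      ring
  · refine tsum_congr fun k => ?_
    have a0 := two_mul_tri (3 * k - 1)
    have a1 := two_mul_tri (3 * k - 1 - 1)
    have a2 := two_mul_tri k
    have a3 := two_mul_tri (k - 1)
    have e1 : tri (3 * k - 1) = 3 * tri k + 6 * tri (k - 1) := by zify; linarith
    have e2 : tri (3 * k - 1 - 1) = 1 + 9 * tri (k - 1) := by zify; linarith
    unfold thetaTerm
    rw [e1, e2]
    ring

/-- The bijection `(a + b + c, a, b) ↦ (a, b, c)`. -/
def sumTripleEquiv : ℤ × (ℤ × ℤ) ≃ ℤ × (ℤ × ℤ) where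
  toFun q := (q.2.1, (q.2.2, q.1 - q.2.1 - q.2.2))
  invFun q := (q.1 + q.2.1 + q.2.2, (q.1, q.2.1))
  left_inv := by rintro ⟨s, a, b⟩; simp
  right_inv := by rintro ⟨a, b, c⟩; simp; ring

/-- Translating three indices of sum r by k raises the sum of their triangular numbers by 3 tri k +
rk, which depends on the indices only through r. The exponents are given as naturals tied by integer
equations, since r and k may be negative. -/
theorem thetaTerm_mul_mul_shift {A : Type*} [CommRing A] (g y : A) (a b k r : ℤ) :
    ∃ U V Q : ℕ, Q = tri a + tri b + tri (r - a - b) ∧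
      (U : ℤ) = Q + 3 * tri k + r * k ∧ (V : ℤ) = U - r - 3 * k ∧
      thetaTerm (g * y ^ 2) y (a + k) * (thetaTerm (g * y ^ 2) y (b + k) *
        thetaTerm (g * y ^ 2) y (r - a - b + k)) = g ^ U * y ^ (2 * U + V) := by
  refine ⟨tri (a + k) + tri (b + k) + tri (r - a - b + k),
    tri (a + k - 1) + tri (b + k - 1) + tri (r - a - b + k - 1), _, rfl, ?_, ?_, ?_⟩
  · have h1 := two_mul_tri a
    have h2 := two_mul_tri b
    have h3 := two_mul_tri (r - a - b)
    have h4 := two_mul_tri (a + k)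
    have h5 := two_mul_tri (b + k)
    have h6 := two_mul_tri (r - a - b + k)
    have h7 := two_mul_tri k
    push_cast
    linarith
  · have h4 := tri_sub_one_add (a + k)
    have h5 := tri_sub_one_add (b + k)
    have h6 := tri_sub_one_add (r - a - b + k)
    push_cast
    linarith
  · unfold thetaTerm
    ring

/-- The triple sum is grouped by the index sum 3k + r with r = 0, -1, -2. Translating the indices by
k separates it into a Borwein sum times a theta series in k. Writing x = g y² keeps quotients such
as x²/y and x/y² integral. -/
theorem theta_cubed {g y : R⟦X⟧} {M : ℕ} (hM : 0 < M) (hgy : g * y ^ 3 = X ^ M) :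
    theta (g * y ^ 2) y ^ 3 =
      borweinTheta 0 (X ^ M) * theta (g ^ 3 * y ^ 6) (y ^ 3) + borweinTheta (-1) (X ^ M) *
        (y * theta (g ^ 2 * y ^ 3) (g * y ^ 6) + y ^ 2 * theta g (g ^ 2 * y ^ 9)) := by
  have hxy : g * y ^ 2 * y = X ^ M := by rw [← hgy]; ring
  have hn := xAdicNull_thetaTerm hM hxy
  have hn3 := hn.mul_prod (hn.mul_prod hn)
  have h3 := (hasSum_thetaTerm hM hxy).mul
    ((hasSum_thetaTerm hM hxy).mul (hasSum_thetaTerm hM hxy) (hn.mul_prod hn).summable)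
    hn3.summable
  set F : ℤ × (ℤ × ℤ) → R⟦X⟧ := fun q => thetaTerm (g * y ^ 2) y q.1 *
    (thetaTerm (g * y ^ 2) y q.2.1 * thetaTerm (g * y ^ 2) y q.2.2) with hF
  have hn3' : XAdicNull fun q => F (sumTripleEquiv q) :=
    hn3.comp_injective sumTripleEquiv.injective
  have hp : (g * y ^ 3) ^ 3 = X ^ (3 * M) := by rw [hgy]; ring
  have hth := fun (u v : R⟦X⟧) (h : u * v = (g * y ^ 3) ^ 3) =>
    (xAdicNull_thetaTerm (x := u) (y := v) (M := 3 * M) (by omega) (h.trans hp)).summable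
  have hB := fun r => (xAdicNull_borweinTheta (R := R) r hM).summable
  have e1 : theta (g * y ^ 2) y ^ 3 =
      ∑' s : ℤ, ∑' ab : ℤ × ℤ, F (sumTripleEquiv (s, ab)) := by
    rw [← hn3'.summable.tsum_prod' fun s => (hn3'.comp_injective
      (Prod.mk_right_injective s)).summable, sumTripleEquiv.tsum_eq, h3.tsum_eq]
    ring
  have key : ∀ (r : ℤ) (t : ℤ → R⟦X⟧),
      (∀ (k : ℤ) (U V Q : ℕ), (U : ℤ) = Q + 3 * tri k + r * k → (V : ℤ) = U - r - 3 * k →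
        g ^ U * y ^ (2 * U + V) = (g * y ^ 3) ^ Q * t k) →
      ∀ k, ∑' ab : ℤ × ℤ, F (sumTripleEquiv (3 * k + r, ab)) = borweinTheta r (X ^ M) * t k := by
    intro r t h k
    rw [borweinTheta, ← (hB r).tsum_mul_right,
      ← ((Equiv.addRight k).prodCongr (Equiv.addRight k)).tsum_eq]
    refine tsum_congr fun ab => ?_
    obtain ⟨U, V, Q, hQ, hU, hV, e⟩ := thetaTerm_mul_mul_shift g y ab.1 ab.2 k r
    rw [← hQ, ← hgy, ← h k U V Q hU hV, ← e]
    simp only [hF, sumTripleEquiv, Equiv.prodCongr_apply, Equiv.coe_fn_mk, Prod.map_fst,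
      Prod.map_snd, Equiv.coe_addRight]
    rw [show 3 * k + r - (ab.1 + k) - (ab.2 + k) = r - ab.1 - ab.2 + k by ring]
  rw [e1, tsum_int_eq_tsum_three hn3'.tsum_fiber]
  have k0 := key 0 (thetaTerm (g ^ 3 * y ^ 6) (y ^ 3)) (by
    intro k U V Q hU hV
    have := tri_sub_one_add k
    have eU : U = Q + 3 * tri k := by omega
    have eV : V = Q + 3 * tri (k - 1) := by omega
    rw [eU, eV, thetaTerm]
    ring)
  have k1 := key (-1) (fun k => y * thetaTerm (g ^ 2 * y ^ 3) (g * y ^ 6) k) (by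
    intro k U V Q hU hV
    have := tri_sub_one_add k
    have eU : U = Q + 2 * tri k + tri (k - 1) := by omega
    have eV : 2 * U + V = 3 * Q + 3 * tri k + 6 * tri (k - 1) + 1 := by omega
    rw [eV, eU, thetaTerm]
    ring)
  have k2 := key (-2) (fun k => y ^ 2 * thetaTerm g (g ^ 2 * y ^ 9) k) (by
    intro k U V Q hU hV
    have := tri_sub_one_add k
    have eU : U = Q + tri k + 2 * tri (k - 1) := by omega
    have eV : 2 * U + V = 3 * Q + 9 * tri (k - 1) + 2 := by omega
    rw [eV, eU, thetaTerm]
    ring)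
  simp only [add_zero, ← sub_eq_add_neg] at k0 k1 k2
  rw [tsum_congr k0, tsum_congr k1, tsum_congr k2, borweinTheta_neg_two,
    (hth _ _ (by ring)).tsum_mul_left, ((hth _ _ (by ring)).mul_left _).tsum_mul_left,
    ((hth _ _ (by ring)).mul_left _).tsum_mul_left, (hth _ _ (by ring)).tsum_mul_left,
    (hth _ _ (by ring)).tsum_mul_left]
  unfold theta
  ring

end Dissection

/-! ### The Borwein cubic theta identities. -/

section CubicIdentities

variable {K : Type*} [CommRing K] {ω : K}

theorem C_primitive_cube_root (hω : ω ^ 2 + ω + 1 = 0) :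
    C ω ^ 2 + C ω + (1 : K⟦X⟧) = 0 ∧ C ω ^ 3 = (1 : K⟦X⟧) := by
  have hc : C ω ^ 2 + C ω + (1 : K⟦X⟧) = 0 := by simpa using congrArg (C (R := K)) hω
  exact ⟨hc, by linear_combination (C ω - 1) * hc⟩

variable [TopologicalSpace K] [DiscreteTopology K]

theorem constantCoeff_theta_X_pow_one (M : ℕ) (hM : M ≠ 0) :
    constantCoeff (theta (X ^ M) 1 : K⟦X⟧) = 2 := by
  have h := tendsto_theta (R := K) (Nat.pos_of_ne_zero hM) (x := X ^ M) (y := 1) (mul_one _)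
  have h2 := ((WithPiTopology.continuous_constantCoeff K).tendsto _).comp h
  refine tendsto_nhds_unique h2 (tendsto_const_nhds.congr' ?_)
  filter_upwards [eventually_gt_atTop 0] with n hn
  obtain ⟨m, rfl⟩ := Nat.exists_eq_add_of_lt hn
  simp only [Function.comp, map_mul, map_prod, pochhammer', map_sub, map_add, map_pow, map_one,
    constantCoeff_X, zero_pow hM, prod_range_succ' _ (0 + m)]
  norm_num

/-- With g = -1 one of the three components of `theta_cubed` contains theta(·, -1) = 0, and the
other two become Euler products. -/
theorem theta_cubed_neg {y : K⟦X⟧} (hy : y ^ 3 = -X ^ 3) :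
    theta (-y ^ 2) y ^ 3 = eulerSeries K 3 three_ne_zero *
      (borweinTheta 0 (X ^ 3) + y * borweinTheta (-1) (X ^ 3)) := by
  have h := theta_cubed (R := K) (g := -1) (y := y) (M := 3) (by norm_num)
    (by rw [hy]; ring)
  rw [neg_one_mul, show (-1) ^ 3 * y ^ 6 = -(X : K⟦X⟧) ^ (2 * 3) by
      linear_combination (-y ^ 3 + X ^ 3) * hy, hy, theta_neg_neg 3 three_ne_zero,
    show (-1) ^ 2 * -X ^ 3 = -(X : K⟦X⟧) ^ 3 by ring,
    show (-1) * y ^ 6 = -(X : K⟦X⟧) ^ (2 * 3) by linear_combination (-y ^ 3 + X ^ 3) * hy,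
    show (-1) ^ 2 * y ^ 9 = -(X : K⟦X⟧) ^ 9 by
      linear_combination (y ^ 6 - y ^ 3 * X ^ 3 + X ^ 6) * hy,
    theta_comm (-1), theta_neg_neg_one 9 (by norm_num), theta_comm (-X ^ 3),
    theta_neg_neg 3 three_ne_zero] at h
  rw [h]
  ring

theorem eulerSeries_cubed : eulerSeries K 1 one_ne_zero ^ 3 = eulerSeries K 3 three_ne_zero *
    (borweinTheta 0 (X ^ 3) - X * borweinTheta (-1) (X ^ 3)) := by
  have h := theta_cubed_neg (K := K) (y := -X ^ 1) (by ring)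
  rw [show -(-X ^ 1) ^ 2 = -(X : K⟦X⟧) ^ (2 * 1) by ring, theta_neg_neg 1 one_ne_zero] at h
  rw [h]
  ring

variable [IsDomain K] [CharZero K]

/-- The product formula for c(q). In `theta_cubed` the choice g = -X, y = -ω² kills the a(q)
component. The left side is evaluated by `theta_cube_root`, and (1-ω²)³ = 3(ω-ω²) cancels. -/
theorem borweinTheta_neg_one_mul (hω : ω ^ 2 + ω + 1 = 0) :
    borweinTheta (-1) (X : K⟦X⟧) * eulerSeries K 1 one_ne_zero =
      3 * eulerSeries K 3 three_ne_zero ^ 3 := by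
  obtain ⟨hc, hw⟩ := C_primitive_cube_root hω
  have hX : (-X : K⟦X⟧) = -X ^ 1 := by rw [pow_one]
  have h := theta_cubed (R := K) (g := -X) (y := -C (ω ^ 2)) one_pos
    (by rw [map_pow]; linear_combination X * (C ω ^ 3 + 1) * hw)
  rw [show -X * (-C (ω ^ 2)) ^ 2 = -(C ω * (X : K⟦X⟧)) by
      rw [map_pow]; linear_combination - X * C ω * hw, theta_cube_root hω,
    show (-X) ^ 3 * (-C (ω ^ 2)) ^ 6 = -(X : K⟦X⟧) ^ 3 by
      rw [map_pow]
      linear_combination -X ^ 3 * ((C ω ^ 3) ^ 3 + (C ω ^ 3) ^ 2 + C ω ^ 3 + 1) * hw,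
    show (-C (ω ^ 2)) ^ 3 = (-1 : K⟦X⟧) by
      rw [map_pow]; linear_combination -(C ω ^ 3 + 1) * hw,
    theta_neg_neg_one 3 three_ne_zero,
    show (-X) ^ 2 * -1 = -(X : K⟦X⟧) ^ (2 * 1) by ring,
    show -X * (-C (ω ^ 2)) ^ 6 = -(X : K⟦X⟧) ^ 1 by
      rw [map_pow, pow_one]
      linear_combination -X * ((C ω ^ 3) ^ 3 + (C ω ^ 3) ^ 2 + C ω ^ 3 + 1) * hw,
    show (-X) ^ 2 * (-C (ω ^ 2)) ^ 9 = -(X : K⟦X⟧) ^ (2 * 1) by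
      rw [map_pow]
      linear_combination -X ^ 2 * ((C ω ^ 3) ^ 5 + (C ω ^ 3) ^ 4 + (C ω ^ 3) ^ 3 +
        (C ω ^ 3) ^ 2 + C ω ^ 3 + 1) * hw,
    theta_comm (-X), hX, theta_neg_neg 1 one_ne_zero, pow_one] at h
  have hne : (C ω - C ω ^ 2 : K⟦X⟧) ≠ 0 := by
    intro h0
    have : (C (-3) : K⟦X⟧) = 0 := by
      have e : (C (-3) : K⟦X⟧) = -3 := by rw [map_neg, map_ofNat]
      rw [e]
      linear_combination (C ω - C ω ^ 2) * h0 - hc - (C ω - 2) * hw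
    have h3 : (-3 : K) = 0 := C_injective (by simpa using this)
    norm_num at h3
  apply mul_left_cancel₀ hne
  rw [map_sub, map_pow, map_one] at h
  linear_combination -h + (-borweinTheta (-1) X * eulerSeries K 1 one_ne_zero * C ω +
    eulerSeries K 3 three_ne_zero ^ 3 * (3 * C ω - 1 - C ω ^ 3)) * hw

/-- This is a³ - c³ = b³ at q³. The left factor is the product of H + yt over y = -X, -ωX, -ω²X,
each being a cube of theta by `theta_cubed_neg`; the product of the three thetas is known from
`theta_mul_theta_mul_theta`. -/
theorem borweinTheta_cubed_sub (hω : ω ^ 2 + ω + 1 = 0) :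
    (borweinTheta 0 (X ^ 3) ^ 3 - X ^ 3 * borweinTheta (-1) (X ^ 3) ^ 3) *
      eulerSeries K 9 (by norm_num) ^ 3 = eulerSeries K 3 three_ne_zero ^ 9 := by
  obtain ⟨hc, hw⟩ := C_primitive_cube_root hω
  have h := theta_mul_theta_mul_theta hω (x := -X ^ 2) (y := -X) (M := 3) (by norm_num) (by ring)
  have h0 := theta_cubed_neg (K := K) (y := -X) (by ring)
  have h1 := theta_cubed_neg (K := K) (y := C ω ^ 2 * -X)
    (by linear_combination -X ^ 3 * (C ω ^ 3 + 1) * hw)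
  have h2 := theta_cubed_neg (K := K) (y := C ω * -X) (by linear_combination -X ^ 3 * hw)
  rw [show -(-X : K⟦X⟧) ^ 2 = -X ^ 2 by ring] at h0
  rw [show -(C ω ^ 2 * -X) ^ 2 = C ω * -(X : K⟦X⟧) ^ 2 by
    linear_combination -X ^ 2 * C ω * hw] at h1
  rw [show -(C ω * -X) ^ 2 = C ω ^ 2 * -(X : K⟦X⟧) ^ 2 by ring] at h2
  rw [show (-X ^ 2) ^ 3 = -(X : K⟦X⟧) ^ (2 * 3) by ring,
    show (-X) ^ 3 = -(X : K⟦X⟧) ^ 3 by ring, theta_neg_neg 3 three_ne_zero] at h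
  have hne : eulerSeries K 3 three_ne_zero ^ 3 ≠ 0 := by
    intro h0
    have := congrArg constantCoeff h0
    simp [constantCoeff_eulerSeries] at this
  apply mul_left_cancel₀ hne
  have hE : (3 * 3 : ℕ) = 9 := by norm_num
  set E := eulerSeries K 3 three_ne_zero
  have h' := congrArg (· ^ 3) h
  simp only [mul_pow, h0, h1, h2] at h'
  set H := (borweinTheta 0 (X ^ 3) : K⟦X⟧)
  set t := (borweinTheta (-1) (X ^ 3) : K⟦X⟧)
  set F := eulerSeries K 9 (by norm_num)
  linear_combination h' + E ^ 3 * F ^ 3 *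
    ((H ^ 2 * (X * t) - H * (X * t) ^ 2 * C ω) * hc + (X * t) ^ 3 * hw)

/-- This is a(q) = b(q) + 3c(q³). The cubes of theta(Xy², y) are summed over the cube roots of unity
y in two ways: `theta_cubed` leaves only the a(q) term, while `theta_eq_add_add` gives 3 times the
product of the thetas plus 27 times the product of the three pieces. Both products are multiples of
theta(X³, 1), which cancels. -/
theorem borweinTheta_zero_mul (hω : ω ^ 2 + ω + 1 = 0) :
    borweinTheta 0 (X : K⟦X⟧) * eulerSeries K 3 three_ne_zero =
      eulerSeries K 1 one_ne_zero ^ 3 + 9 * X * eulerSeries K 9 (by norm_num) ^ 3 := by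
  obtain ⟨hc, hw⟩ := C_primitive_cube_root hω
  have h12 : ∀ y : K⟦X⟧, y ^ 3 = 1 → theta (X * y ^ 2) y ^ 3 = borweinTheta 0 X *
      theta (X ^ 3) 1 + borweinTheta (-1) X * (y * theta (X ^ 2) X + y ^ 2 * theta X (X ^ 2)) := by
    intro y hy
    have h := theta_cubed (R := K) (g := X) (y := y) one_pos (by rw [hy]; ring)
    simpa only [show y ^ 6 = 1 by linear_combination (y ^ 3 + 1) * hy, hy,
      show y ^ 9 = 1 by linear_combination (y ^ 6 + y ^ 3 + 1) * hy, mul_one, pow_one] using h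
  have h1 : ∀ y : K⟦X⟧, y ^ 3 = 1 → theta (X * y ^ 2) y = theta (X ^ 6) (X ^ 3) +
      y ^ 2 * (X * theta (X ^ 9) 1) + y * theta (X ^ 3) (X ^ 6) := by
    intro y hy
    have h := theta_eq_add_add (R := K) (x := X * y ^ 2) (y := y) one_pos
      (by linear_combination X * hy)
    rw [show (X * y ^ 2) ^ 6 * y ^ 3 = X ^ 6 * (y ^ 3) ^ 5 by ring,
      show (X * y ^ 2) ^ 3 * y ^ 6 = X ^ 3 * (y ^ 3) ^ 4 by ring,
      show (X * y ^ 2) ^ 9 * y ^ 6 = X ^ 9 * (y ^ 3) ^ 8 by ring,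
      show (X * y ^ 2) ^ 3 = X ^ 3 * (y ^ 3) ^ 2 by ring,
      show (X * y ^ 2) ^ 6 * y ^ 9 = X ^ 6 * (y ^ 3) ^ 7 by ring, hy] at h
    simp only [one_pow, mul_one] at h
    rw [h]
    ring
  have hp := theta_mul_theta_mul_theta hω (x := X) (y := 1) (M := 1) one_ne_zero (by ring)
  have hq := theta_mul_theta_mul_theta_eq (R := K) (Z := 1) (W := 1) (mul_one 1) (M := 3)
    (by norm_num)
  have s0 := h12 1 (one_pow 3)
  have s1 := h12 (C ω ^ 2) (by linear_combination (C ω ^ 3 + 1) * hw)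
  have s2 := h12 (C ω) hw
  have t0 := h1 1 (one_pow 3)
  have t1 := h1 (C ω ^ 2) (by linear_combination (C ω ^ 3 + 1) * hw)
  have t2 := h1 (C ω) hw
  have hne : theta (X ^ 3) (1 : K⟦X⟧) ≠ 0 := by
    intro h0
    have := constantCoeff_theta_X_pow_one (K := K) 3 (by norm_num)
    rw [h0, map_zero] at this
    norm_num at this
  rw [show X * (1 : K⟦X⟧) ^ 2 = X by ring] at s0 t0
  rw [show X * (C ω ^ 2) ^ 2 = C ω * (X : K⟦X⟧) by linear_combination X * C ω * hw] at s1 t1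
  rw [show X * (C ω) ^ 2 = C ω ^ 2 * (X : K⟦X⟧) by ring] at s2 t2
  simp only [mul_one, one_mul, one_pow] at hp hq s0 t0
  rw [t0, t1, t2] at hp
  rw [t0] at s0
  rw [t1] at s1
  rw [t2] at s2
  have hne3 : (3 : K⟦X⟧) ≠ 0 := by
    intro h0
    have := congrArg constantCoeff h0
    rw [map_ofNat, map_zero] at this
    norm_num at this
  apply mul_left_cancel₀ (mul_ne_zero hne3 hne)
  generalize C ω = w at *
  set A := (theta (X ^ 6) (X ^ 3) : K⟦X⟧)
  set B := (theta (X ^ 9) 1 : K⟦X⟧)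
  set D := (theta (X ^ 3) (X ^ 6) : K⟦X⟧)
  set T := (theta (X ^ 3) 1 : K⟦X⟧)
  have hsum : (A + X * B + D) ^ 3 + (A + (w ^ 2) ^ 2 * (X * B) + w ^ 2 * D) ^ 3 +
      (A + w ^ 2 * (X * B) + w * D) ^ 3 = 3 * ((A + X * B + D) *
        (A + (w ^ 2) ^ 2 * (X * B) + w ^ 2 * D) * (A + w ^ 2 * (X * B) + w * D) +
        9 * (A * (X * B) * D)) := by
    generalize X * B = B
    clear * - hw hc
    grind
  rw [s0, s1, s2] at hsum
  have hq' : B * A * D * eulerSeries K 3 three_ne_zero = eulerSeries K 9 (by norm_num) ^ 3 * T := hq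
  set P := (A + X * B + D) * (A + (w ^ 2) ^ 2 * (X * B) + w ^ 2 * D) *
    (A + w ^ 2 * (X * B) + w * D)
  have hp' : P * eulerSeries K 3 three_ne_zero = eulerSeries K 1 one_ne_zero ^ 3 * T := hp
  linear_combination eulerSeries K 3 three_ne_zero * hsum + 3 * hp' + 27 * X * hq' -
    eulerSeries K 3 three_ne_zero * borweinTheta (-1) X *
      ((theta (X ^ 2) X + theta X (X ^ 2)) * hc + theta X (X ^ 2) * w * hw)

end CubicIdentities

/-! ### Constant terms in z. -/

section ConstantTerm

variable {K : Type*} [CommRing K]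

/-- The constant term in `z` of a power series with coefficients in `K[z, z⁻¹]`. -/
noncomputable def constTerm : K[T;T⁻¹]⟦X⟧ →+ K⟦X⟧ where
  toFun F := PowerSeries.mk fun n => (coeff n F).coeff 0
  map_zero' := by ext n; simp
  map_add' F G := by ext n; simp

theorem coeff_constTerm (F : K[T;T⁻¹]⟦X⟧) (n : ℕ) :
    coeff n (constTerm F) = (coeff n F).coeff 0 := by simp [constTerm]

theorem constTerm_map_mul (g : K⟦X⟧) (F : K[T;T⁻¹]⟦X⟧) :
    constTerm (map LaurentPolynomial.C g * F) = g * constTerm F := by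
  ext n
  rw [coeff_constTerm, PowerSeries.coeff_mul, PowerSeries.coeff_mul, AddMonoidAlgebra.coeff_sum,
    Finsupp.finsetSum_apply]
  refine sum_congr rfl fun p _ => ?_
  rw [coeff_map, coeff_constTerm, ← LaurentPolynomial.single_eq_C,
    AddMonoidAlgebra.coeff_single_zero_mul]

theorem constTerm_C_T_mul_X_pow (a : K) (m : ℤ) (k : ℕ) :
    constTerm (C (LaurentPolynomial.C a * LaurentPolynomial.T m) * X ^ k) =
      if m = 0 then C a * X ^ k else 0 := by
  ext n
  rw [coeff_constTerm, coeff_C_mul, coeff_X_pow, ← LaurentPolynomial.single_eq_C_mul_T]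
  split_ifs with h1 h2 h2 <;> simp [-LaurentPolynomial.single_eq_C_mul_T, coeff_X_pow, h1, h2]

variable [TopologicalSpace K] [TopologicalSpace K[T;T⁻¹]] [DiscreteTopology K[T;T⁻¹]]

theorem continuous_constTerm : Continuous (constTerm : K[T;T⁻¹]⟦X⟧ → K⟦X⟧) :=
  continuous_of_coeff_eq id (fun _ r => r.coeff 0) fun F n => coeff_constTerm F n

theorem hasSum_constTerm_theta (j m : ℤ) (a b : ℕ) (hab : 0 < a + b) :
    HasSum (fun k : ℤ => if j + m * k = 0 then (X : K⟦X⟧) ^ (a * tri k + b * tri (k - 1)) else 0)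
      (constTerm (C (LaurentPolynomial.T j) * theta (C (LaurentPolynomial.T m) * X ^ a)
        (C (LaurentPolynomial.T (-m)) * X ^ b))) := by
  have hxy : (C (LaurentPolynomial.T m : K[T;T⁻¹]) * X ^ a) *
      (C (LaurentPolynomial.T (-m)) * X ^ b) = X ^ (a + b) := by
    rw [mul_mul_mul_comm, ← map_mul, ← LaurentPolynomial.T_add, add_neg_cancel,
      LaurentPolynomial.T_zero, map_one, one_mul, pow_add]
  have h := ((hasSum_thetaTerm hab hxy).mul_left (C (LaurentPolynomial.T j))).map
    (constTerm (K := K)) continuous_constTerm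
  convert h using 2 with k
  have := tri_sub_one_add k
  have e : C (LaurentPolynomial.T j : K[T;T⁻¹]) * thetaTerm (C (LaurentPolynomial.T m) * X ^ a)
      (C (LaurentPolynomial.T (-m)) * X ^ b) k =
      C (LaurentPolynomial.C 1 * LaurentPolynomial.T (j + m * k)) *
        X ^ (a * tri k + b * tri (k - 1)) := by
    unfold thetaTerm
    rw [mul_pow, mul_pow, ← map_pow, ← map_pow, LaurentPolynomial.T_pow, LaurentPolynomial.T_pow,
      mul_mul_mul_comm, ← map_mul, ← mul_assoc, ← map_mul, ← LaurentPolynomial.T_add,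
      ← LaurentPolynomial.T_add, ← pow_mul, ← pow_mul, ← pow_add, map_one, one_mul]
    congr 3
    rw [← this]
    ring
  rw [Function.comp_apply, e, constTerm_C_T_mul_X_pow, map_one, one_mul]

variable [DiscreteTopology K]

theorem constTerm_theta_eq {j m k : ℤ} {a b : ℕ} (hab : 0 < a + b) (hm : m ≠ 0)
    (hk : j + m * k = 0) :
    constTerm (C (LaurentPolynomial.T j : K[T;T⁻¹]) * theta (C (LaurentPolynomial.T m) * X ^ a)
        (C (LaurentPolynomial.T (-m)) * X ^ b)) = X ^ (a * tri k + b * tri (k - 1)) := by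
  refine (hasSum_constTerm_theta j m a b hab).unique ?_
  convert hasSum_single k ?_ using 1
  · rw [if_pos hk]
  · intro k' hk'
    refine if_neg fun h => hk' ?_
    have : m * (k' - k) = 0 := by linear_combination h - hk
    rcases mul_eq_zero.1 this with h' | h'
    · exact absurd h' hm
    · omega

theorem constTerm_theta_eq_zero {j m : ℤ} {a b : ℕ} (hab : 0 < a + b)
    (hk : ∀ k, j + m * k ≠ 0) :
    constTerm (C (LaurentPolynomial.T j : K[T;T⁻¹]) * theta (C (LaurentPolynomial.T m) * X ^ a)
        (C (LaurentPolynomial.T (-m)) * X ^ b)) = 0 := by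
  refine (hasSum_constTerm_theta j m a b hab).unique ?_
  simp only [hk, if_false]
  exact hasSum_zero

end ConstantTerm

/-! ### Frobenius partitions as a constant term of a theta power. -/

section Frobenius

/-- The colored integers with underlying integer less than `N`. -/
def coloredRange (k N : ℕ) : Finset (ColoredNat k) :=
  (range N ×ˢ (univ : Finset (Fin k))).map toLex.toEmbedding

theorem mem_coloredRange {k N : ℕ} {a : ColoredNat k} : a ∈ coloredRange k N ↔ a.value < N := by
  simp only [coloredRange, mem_map_equiv, mem_product, mem_range, mem_univ, and_true]
  rfl

theorem prod_coloredRange {A : Type*} [CommMonoid A] (k N : ℕ) (f : ℕ → A) :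
    ∏ a ∈ coloredRange k N, f a.value = (∏ j ∈ range N, f j) ^ k := by
  rw [coloredRange, prod_map, prod_product, ← prod_pow]
  refine prod_congr rfl fun j _ => ?_
  simp [ColoredNat.value]

/-- Pairs of finite sets of colored integers encoding generalized Frobenius partitions of `n`. -/
def frobeniusPairs (k N n : ℕ) : Finset (Finset (ColoredNat k) × Finset (ColoredNat k)) :=
  ((coloredRange k N).powerset ×ˢ (coloredRange k N).powerset).filter fun ST =>
    ST.1.card = ST.2.card ∧
      ST.1.card + (∑ a ∈ ST.1, a.value + ∑ a ∈ ST.2, a.value) = n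

theorem sum_value_toFinset {k : ℕ} {l : List (ColoredNat k)} (h : l.Pairwise fun x y => y < x) :
    ∑ a ∈ l.toFinset, a.value = (l.map ColoredNat.value).sum :=
  List.sum_toFinset _ (h.imp fun h => h.ne')

/-- A strictly decreasing row is the sorted list of a finite set, and no entry of a partition of n
exceeds n < N. -/
theorem card_frobeniusPairs {k N n : ℕ} (h : n < N) : (frobeniusPairs k N n).card = cphi k n := by
  have hcard : ∀ {l : List (ColoredNat k)}, l.Pairwise (fun x y => y < x) →
      l.toFinset.card = l.length := fun h =>
    List.toFinset_card_of_nodup (h.imp fun h => h.ne')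
  have hle : ∀ {S : Finset (ColoredNat k)}, ∑ a ∈ S, a.value ≤ n → S ⊆ coloredRange k N := by
    intro S hS a ha
    have := single_le_sum (f := ColoredNat.value) (fun _ _ => Nat.zero_le _) ha
    rw [mem_coloredRange]
    omega
  rw [cphi, ← Fintype.card_coe, ← Nat.card_eq_fintype_card]
  symm
  refine Nat.card_eq_of_bijective (fun P => ⟨(P.1.top.toFinset, P.1.bottom.toFinset), ?_⟩)
    ⟨?_, ?_⟩
  · obtain ⟨P, hP⟩ := P
    have hsize := hP
    rw [GenFrobeniusPartition.size, ← sum_value_toFinset P.top_decreasing,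
      ← sum_value_toFinset P.bottom_decreasing] at hsize
    simp only [frobeniusPairs, mem_filter, mem_product, mem_powerset, hcard P.top_decreasing,
      hcard P.bottom_decreasing]
    exact ⟨⟨hle (by omega), hle (by omega)⟩, P.length_eq, hsize⟩
  · rintro ⟨P, hP⟩ ⟨Q, hQ⟩ hPQ
    simp only [Subtype.mk.injEq, Prod.mk.injEq] at hPQ
    have heq : ∀ {l m : List (ColoredNat k)}, l.Pairwise (fun x y => y < x) →
        m.Pairwise (fun x y => y < x) → l.toFinset = m.toFinset → l = m := by
      intro l m hl hm h
      refine List.Perm.eq_of_pairwise' ?_ ?_ (List.perm_of_nodup_nodup_toFinset_eq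
        (hl.imp fun h => h.ne') (hm.imp fun h => h.ne') h) (r := fun x y => y ≤ x)
      · exact hl.imp fun h => h.le
      · exact hm.imp fun h => h.le
    exact Subtype.ext (GenFrobeniusPartition.ext
      (heq P.top_decreasing Q.top_decreasing hPQ.1)
      (heq P.bottom_decreasing Q.bottom_decreasing hPQ.2))
  · rintro ⟨⟨S, T⟩, hST⟩
    simp only [frobeniusPairs, mem_filter] at hST
    have hsort : ∀ S : Finset (ColoredNat k), (S.sort (· ≥ ·)).Pairwise fun x y => y < x :=
      fun S => (sortedGT_sort S).pairwise
    refine ⟨⟨⟨S.sort (· ≥ ·), T.sort (· ≥ ·), hsort S, hsort T, ?_⟩, ?_⟩, ?_⟩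
    · rw [length_sort, length_sort, hST.2.1]
    · rw [GenFrobeniusPartition.size]
      simp only [← sum_value_toFinset (hsort _), sort_toFinset, length_sort]
      exact hST.2.2
    · simp only [sort_toFinset]

theorem one_add_prod_expand {A : Type*} [CommRing A] (k N : ℕ) (x q : A) :
    (∏ j ∈ range N, (1 + x * q ^ j)) ^ k =
      ∑ S ∈ (coloredRange k N).powerset, x ^ S.card * q ^ (∑ a ∈ S, a.value) := by
  rw [← prod_coloredRange k N fun j => 1 + x * q ^ j, prod_one_add]
  refine sum_congr rfl fun S _ => ?_
  rw [prod_mul_distrib, prod_const, prod_pow_eq_pow_sum]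

variable {K : Type*} [CommRing K]

/-- Expanding over subsets S, T gives z-degree |S| - |T|. For equal cardinalities the scalars
contribute (αβ)^|S| = 1, so a twist of z leaves the constant term unchanged. -/
theorem coeff_constTerm_prod {k N n : ℕ} (h : n < N) {α β : K} (hαβ : α * β = 1) :
    coeff n (constTerm (((∏ j ∈ range N,
      (1 + C (LaurentPolynomial.C α * LaurentPolynomial.T 1) * X * X ^ j)) *
      ∏ j ∈ range N, (1 + C (LaurentPolynomial.C β * LaurentPolynomial.T (-1)) * X ^ j)) ^ k)) =
    (cphi k n : K) := by
  have key : ∀ S T : Finset (ColoredNat k), constTerm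
      ((C (LaurentPolynomial.C α * LaurentPolynomial.T 1) * X) ^ S.card *
        X ^ (∑ a ∈ S, a.value) * ((C (LaurentPolynomial.C β * LaurentPolynomial.T (-1))) ^ T.card *
          X ^ (∑ a ∈ T, a.value))) =
      if S.card = T.card then
        (X : K⟦X⟧) ^ (S.card + (∑ a ∈ S, a.value + ∑ a ∈ T, a.value)) else 0 := by
    intro S T
    have e : (C (LaurentPolynomial.C α * LaurentPolynomial.T 1) * X) ^ S.card *
        X ^ (∑ a ∈ S, a.value) * ((C (LaurentPolynomial.C β * LaurentPolynomial.T (-1))) ^ T.card *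
          X ^ (∑ a ∈ T, a.value)) =
        C (LaurentPolynomial.C (α ^ S.card * β ^ T.card) *
          LaurentPolynomial.T (S.card - T.card)) *
        (X : K[T;T⁻¹]⟦X⟧) ^ (S.card + (∑ a ∈ S, a.value + ∑ a ∈ T, a.value)) := by
      rw [sub_eq_add_neg, LaurentPolynomial.T_add, ← mul_one (S.card : ℤ), ← LaurentPolynomial.T_pow,
        ← mul_neg_one (T.card : ℤ), ← LaurentPolynomial.T_pow]
      simp only [map_mul, map_pow]
      ring
    rw [e, constTerm_C_T_mul_X_pow]
    by_cases hST : S.card = T.card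
    · rw [if_pos hST, if_pos (by simp [hST]), hST, ← mul_pow, hαβ, one_pow, map_one, one_mul]
    · rw [if_neg hST, if_neg (by omega)]
  rw [mul_pow, one_add_prod_expand, one_add_prod_expand, sum_mul_sum, ← sum_product', map_sum,
    map_sum, ← card_frobeniusPairs h, frobeniusPairs, card_filter, Nat.cast_sum]
  refine sum_congr rfl fun ST _ => ?_
  rw [key]
  by_cases hST : ST.1.card = ST.2.card
  · simp [hST, coeff_X_pow, eq_comm]
  · simp [hST]

variable [TopologicalSpace K] [DiscreteTopology K] [TopologicalSpace K[T;T⁻¹]]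
  [DiscreteTopology K[T;T⁻¹]]

theorem constTerm_theta_pow (k : ℕ) {α β : K} (hαβ : α * β = 1) :
    constTerm (theta (C (LaurentPolynomial.C α * LaurentPolynomial.T 1) * X)
      (C (LaurentPolynomial.C β * LaurentPolynomial.T (-1))) ^ k) =
    eulerSeries K 1 one_ne_zero ^ k * PowerSeries.mk fun n => (cphi k n : K) := by
  have hxy : (C (LaurentPolynomial.C α * LaurentPolynomial.T 1) * X) *
      (C (LaurentPolynomial.C β * LaurentPolynomial.T (-1))) = (X : K[T;T⁻¹]⟦X⟧) ^ 1 := by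
    rw [mul_right_comm, ← map_mul, mul_mul_mul_comm, ← map_mul, ← LaurentPolynomial.T_add, hαβ]
    simp
  have h := (continuous_constTerm (K := K)).continuousAt.tendsto.comp
    ((tendsto_theta one_pos hxy).pow k)
  have hlim : Tendsto (fun N => constTerm (((∏ j ∈ range N,
      (1 + C (LaurentPolynomial.C α * LaurentPolynomial.T 1) * X * X ^ j)) *
      ∏ j ∈ range N, (1 + C (LaurentPolynomial.C β * LaurentPolynomial.T (-1)) * X ^ j)) ^ k))
      atTop (𝓝 (PowerSeries.mk fun n => (cphi k n : K))) := by
    rw [WithPiTopology.tendsto_iff_coeff_tendsto]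
    intro n
    refine tendsto_atTop_of_eventually_const (i₀ := n + 1) fun N hN => ?_
    rw [coeff_constTerm_prod (by omega) hαβ, coeff_mk]
  refine tendsto_nhds_unique h
    ((((tendsto_pochhammer' 1 one_ne_zero).pow k).mul hlim).congr fun N => ?_)
  rw [← constTerm_map_mul, Function.comp_apply, mul_pow]
  congr 1
  simp [pochhammer', map_prod, mul_pow]

end Frobenius

/-! ### The generating function of cφ_9. -/

section GeneratingFunction

theorem map_borweinTheta {R S : Type*} [CommRing R] [CommRing S] [TopologicalSpace R]
    [DiscreteTopology R] [TopologicalSpace S] [DiscreteTopology S] (f : R →+* S) (r : ℤ) (N : ℕ)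
    (hN : N ≠ 0) : PowerSeries.map f (borweinTheta r (X ^ N : R⟦X⟧)) = borweinTheta r (X ^ N) := by
  have h := (xAdicNull_borweinTheta (R := R) r (Nat.pos_of_ne_zero hN)).summable.hasSum.map
    (PowerSeries.map f) (continuous_of_coeff_eq id (fun _ => f) fun F n => coeff_map f n F)
  rw [borweinTheta, ← h.tsum_eq, borweinTheta]
  refine tsum_congr fun ab => ?_
  simp [Function.comp]

variable {K : Type*} [CommRing K] [TopologicalSpace K] [DiscreteTopology K] [IsDomain K]
  [CharZero K] {ω : K}

/-- With t standing for z, a twist by a cube root of unity y enters the three components only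
through 1, y, y². -/
theorem theta_cubed_twist {R : Type*} [CommRing R] [TopologicalSpace R] [DiscreteTopology R]
    {t t' y : R⟦X⟧} (ht : t * t' = 1) (hy : y ^ 3 = 1) :
    theta (y ^ 2 * (t * X)) (y * t') ^ 3 = borweinTheta 0 X * theta (t ^ 3 * X ^ 3) (t' ^ 3) +
      borweinTheta (-1) X * (y * (t' * theta (t ^ 3 * X ^ 2) (t' ^ 3 * X)) +
        y ^ 2 * (t' ^ 2 * theta (t ^ 3 * X) (t' ^ 3 * X ^ 2))) := by
  have h := theta_cubed (R := R) (g := t ^ 3 * X) (y := y * t') one_pos (by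
    rw [show t ^ 3 * X * (y * t') ^ 3 = X * (t * t') ^ 3 * y ^ 3 by ring, ht, hy]; ring)
  rw [show t ^ 3 * X * (y * t') ^ 2 = y ^ 2 * (t * X) * (t * t') ^ 2 by ring,
    show (t ^ 3 * X) ^ 3 * (y * t') ^ 6 = t ^ 3 * X ^ 3 * (t * t') ^ 6 * (y ^ 3) ^ 2 by ring,
    show (y * t') ^ 3 = t' ^ 3 * y ^ 3 by ring,
    show (t ^ 3 * X) ^ 2 * (t' ^ 3 * y ^ 3) = t ^ 3 * X ^ 2 * (t * t') ^ 3 * y ^ 3 by ring,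
    show t ^ 3 * X * (y * t') ^ 6 = t' ^ 3 * X * (t * t') ^ 3 * (y ^ 3) ^ 2 by ring,
    show (t ^ 3 * X) ^ 2 * (y * t') ^ 9 = t' ^ 3 * X ^ 2 * (t * t') ^ 6 * (y ^ 3) ^ 3 by ring,
    ht, hy] at h
  simp only [one_pow, mul_one, pow_one] at h
  rw [h]
  ring

/-- The factor E_1^9 comes from the triple product; the further E_3³ E_1 clears the denominators of
the two theta product formulas. -/
theorem mul_genFun_cphi_nine (hω : ω ^ 2 + ω + 1 = 0) :
    eulerSeries K 3 three_ne_zero ^ 3 * eulerSeries K 1 one_ne_zero ^ 10 *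
      PowerSeries.mk (fun n => (cphi 9 n : K)) =
    eulerSeries K 1 one_ne_zero ^ 10 * borweinTheta 0 (X ^ 3) +
      9 * borweinTheta 0 X * borweinTheta (-1) X ^ 2 * eulerSeries K 3 three_ne_zero ^ 6 * X := by
  let _ : TopologicalSpace K[T;T⁻¹] := ⊥
  have : DiscreteTopology K[T;T⁻¹] := ⟨rfl⟩
  have hωL : LaurentPolynomial.C ω ^ 2 + LaurentPolynomial.C ω + 1 = (0 : K[T;T⁻¹]) := by
    simpa using congrArg LaurentPolynomial.C hω
  have hω3 : ω ^ 3 = 1 := by linear_combination (ω - 1) * hω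
  obtain ⟨hc, hw⟩ := C_primitive_cube_root hωL
  set w : K[T;T⁻¹]⟦X⟧ := C (LaurentPolynomial.C ω) with hwdef
  set t : K[T;T⁻¹]⟦X⟧ := C (LaurentPolynomial.T 1) with htdef
  set t' : K[T;T⁻¹]⟦X⟧ := C (LaurentPolynomial.T (-1)) with htdef'
  have ht : t * t' = 1 := by
    rw [htdef, htdef', ← map_mul, ← LaurentPolynomial.T_add]
    simp
  have htn : ∀ n : ℕ, t ^ n = C (LaurentPolynomial.T n) := fun n => by
    rw [htdef, ← map_pow, LaurentPolynomial.T_pow, mul_one]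
  have htn' : ∀ n : ℕ, t' ^ n = C (LaurentPolynomial.T (-n)) := fun n => by
    rw [htdef', ← map_pow, LaurentPolynomial.T_pow, mul_neg_one]
  -- the three twists of the ninth power
  have p0 := constTerm_theta_pow (K := K) 9 (one_mul (1 : K))
  have p1 := constTerm_theta_pow (K := K) 9 (show ω * ω ^ 2 = 1 by rw [← hω3]; ring)
  have p2 := constTerm_theta_pow (K := K) 9 (show ω ^ 2 * ω = 1 by rw [← hω3]; ring)
  simp only [map_one, one_mul, map_mul, map_pow, ← htdef, ← htdef', ← hwdef, mul_assoc] at p0 p1 p2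
  have c0 := theta_cubed_twist ht (one_pow 3)
  have c1 := theta_cubed_twist ht (show (w ^ 2) ^ 3 = 1 by linear_combination (w ^ 3 + 1) * hw)
  have c2 := theta_cubed_twist ht hw
  rw [show (w ^ 2) ^ 2 * (t * X) = w * (t * X) by linear_combination w * t * X * hw] at c1
  simp only [one_pow, one_mul] at c0
  have hprod := theta_mul_theta_mul_theta hωL (x := t * X) (y := t') (M := 1) one_ne_zero
    (by linear_combination X * ht)
  have hq := theta_mul_theta_mul_theta_eq (Z := t ^ 3) (W := t' ^ 3)
    (by rw [← mul_pow, ht, one_pow]) (M := 1) one_ne_zero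
  rw [← hwdef, mul_pow] at hprod
  simp only [mul_one, pow_one] at hprod hq
  -- The cube of U = theta(z³X³, z⁻³) is dissected once more, into theta series in z^9, so that its
  -- constant term can be read off.
  have hX := theta_cubed (R := K[T;T⁻¹]) (g := t ^ 9 * X ^ 3) (y := t' ^ 3) (M := 3) (by norm_num)
    (by rw [show t ^ 9 * X ^ 3 * (t' ^ 3) ^ 3 = X ^ 3 * (t * t') ^ 9 by ring, ht]; ring)
  rw [show t ^ 9 * X ^ 3 * (t' ^ 3) ^ 2 = t ^ 3 * X ^ 3 * (t * t') ^ 6 by ring,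
    show (t ^ 9 * X ^ 3) ^ 3 * (t' ^ 3) ^ 6 = t ^ 9 * X ^ 9 * (t * t') ^ 18 by ring,
    show (t' ^ 3) ^ 3 = t' ^ 9 by ring,
    show (t ^ 9 * X ^ 3) ^ 2 * t' ^ 9 = t ^ 9 * X ^ 6 * (t * t') ^ 9 by ring,
    show t ^ 9 * X ^ 3 * (t' ^ 3) ^ 6 = t' ^ 9 * X ^ 3 * (t * t') ^ 9 by ring,
    show (t ^ 9 * X ^ 3) ^ 2 * (t' ^ 3) ^ 9 = t' ^ 9 * X ^ 6 * (t * t') ^ 18 by ring, ht,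
    show (t' ^ 3) ^ 2 = t' ^ 6 by ring] at hX
  simp only [one_pow, mul_one] at hX
  -- Of the pieces of U³ only the first has z-exponents including 0; the shifts -3 and -6 are not
  -- multiples of 9. In z⁻³ theta(z³X, z⁻³) the index 1 survives and yields the factor X.
  have k1 := constTerm_theta_eq (K := K) (j := 0) (m := 9) (k := 0) (a := 9) (b := 0)
    (by norm_num) (by norm_num) (by norm_num)
  have k2 := constTerm_theta_eq_zero (K := K) (j := -3) (m := 9) (a := 6) (b := 3)
    (by norm_num) (fun k => by omega)
  have k3 := constTerm_theta_eq_zero (K := K) (j := -6) (m := 9) (a := 3) (b := 6)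
    (by norm_num) (fun k => by omega)
  have k4 := constTerm_theta_eq (K := K) (j := -3) (m := 3) (k := 1) (a := 1) (b := 0)
    (by norm_num) (by norm_num) (by norm_num)
  have n9 := htn 9
  have n9' := htn' 9
  have n3 := htn 3
  have n3' := htn' 3
  have n6' := htn' 6
  push_cast at n9 n9' n3 n3' n6'
  rw [← n9, ← n9', ← n3'] at k2
  rw [← n9, ← n9', ← n6'] at k3
  rw [← n9, ← n9'] at k1
  rw [← n3, ← n3'] at k4
  simp only [tri, pow_zero, mul_one, LaurentPolynomial.T_zero, map_one, one_mul, pow_one] at k1 k4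
  norm_num at k1 k4
  set L := (LaurentPolynomial.C : K →+* K[T;T⁻¹])
  have hE : ∀ M hM, eulerSeries K[T;T⁻¹] M hM = PowerSeries.map L (eulerSeries K M hM) := fun M hM =>
    (map_eulerSeries _ _ _).symm
  have hB : ∀ r, borweinTheta r (X : K[T;T⁻¹]⟦X⟧) = PowerSeries.map L (borweinTheta r X) := fun r => by
    have := map_borweinTheta L r 1 one_ne_zero
    simpa using this.symm
  have hB3 : ∀ r, borweinTheta r (X ^ 3 : K[T;T⁻¹]⟦X⟧) = PowerSeries.map L (borweinTheta r (X ^ 3)) :=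
    fun r => (map_borweinTheta L r 3 three_ne_zero).symm
  set T0 := theta (t * X) t'
  set T1 := theta (w * (t * X)) (w ^ 2 * t')
  set T2 := theta (w ^ 2 * (t * X)) (w * t')
  set U := theta (t ^ 3 * X ^ 3) (t' ^ 3)
  set Y1 := theta (t ^ 3 * X ^ 2) (t' ^ 3 * X)
  set Y2 := theta (t ^ 3 * X) (t' ^ 3 * X ^ 2)
  set Q := theta (t ^ 3 * X) (t' ^ 3)
  set e1 := eulerSeries K 1 one_ne_zero with he1
  set e3 := eulerSeries K 3 three_ne_zero with he3
  have hprod' : T0 * T1 * T2 * PowerSeries.map L e3 = PowerSeries.map L e1 ^ 3 * U := by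
    rw [he1, he3, ← hE, ← hE]; exact hprod
  have hq' : U * Y1 * Y2 * PowerSeries.map L e1 = PowerSeries.map L e3 ^ 3 * Q := by
    rw [he1, he3, ← hE, ← hE]; exact hq
  rw [hB, hB] at c0 c1 c2
  rw [hB3, hB3] at hX
  set h0 := borweinTheta 0 (X : K⟦X⟧)
  set h1 := borweinTheta (-1) (X : K⟦X⟧)
  have hUct : constTerm (U ^ 3) = borweinTheta 0 (X ^ 3) := by
    rw [hX, map_add, mul_add, map_add, constTerm_map_mul, constTerm_map_mul, constTerm_map_mul,
      k1, k2, k3]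
    ring
  -- Each cube is A + B + D with B, D twisted by cube roots of unity; the sum of the cubes of the
  -- three twists exceeds 3 times their product by 27ABD.
  have hsum : T0 ^ 9 + T1 ^ 9 + T2 ^ 9 = 3 * (T0 * T1 * T2) ^ 3 +
      27 * PowerSeries.map L h0 * PowerSeries.map L h1 ^ 2 * (t' ^ 3 * (U * Y1 * Y2)) := by
    have e : T0 ^ 9 + T1 ^ 9 + T2 ^ 9 - 3 * (T0 * T1 * T2) ^ 3 =
      (T0 ^ 3) ^ 3 + (T1 ^ 3) ^ 3 + (T2 ^ 3) ^ 3 - 3 * (T0 ^ 3 * T1 ^ 3 * T2 ^ 3) := by ring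
    have e' : (T0 ^ 3) ^ 3 + (T1 ^ 3) ^ 3 + (T2 ^ 3) ^ 3 - 3 * (T0 ^ 3 * T1 ^ 3 * T2 ^ 3) =
        27 * PowerSeries.map L h0 * PowerSeries.map L h1 ^ 2 * (t' ^ 3 * (U * Y1 * Y2)) := by
      rw [c0, c1, c2]
      generalize PowerSeries.map L h0 = a0
      generalize PowerSeries.map L h1 = a1
      clear_value w t' U Y1 Y2
      clear * - hc hw
      have hlin : ∀ A B D : K[T;T⁻¹]⟦X⟧, (A + (B + D)) ^ 3 + (A + (w ^ 2 * B + (w ^ 2) ^ 2 * D)) ^ 3 +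
          (A + (w * B + w ^ 2 * D)) ^ 3 - 3 * ((A + (B + D)) * (A + (w ^ 2 * B + (w ^ 2) ^ 2 * D)) *
          (A + (w * B + w ^ 2 * D))) = 27 * (A * B * D) := by
        intro A B D
        grind
      have := hlin (a0 * U) (a1 * (t' * Y1)) (a1 * (t' ^ 2 * Y2))
      linear_combination this
    linear_combination e + e'
  have hmul : PowerSeries.map L (e3 ^ 3 * e1) * (T0 ^ 9 + T1 ^ 9 + T2 ^ 9) =
      PowerSeries.map L (3 * e1 ^ 10) * U ^ 3 + PowerSeries.map L (27 * h0 * h1 ^ 2 * e3 ^ 6) * (t' ^ 3 * Q) := by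
    rw [hsum]
    simp only [map_mul, map_pow, map_ofNat]
    have hp3 := congrArg (· ^ 3) hprod'
    simp only [mul_pow] at hp3
    linear_combination 3 * PowerSeries.map L e1 * hp3 +
      27 * PowerSeries.map L h0 * PowerSeries.map L h1 ^ 2 * PowerSeries.map L e3 ^ 3 * t' ^ 3 * hq'
  have hfin := congrArg constTerm hmul
  rw [constTerm_map_mul, map_add, map_add, map_add, constTerm_map_mul, constTerm_map_mul, p0, p1,
    p2, hUct, k4] at hfin
  have hne3 : (3 : K⟦X⟧) ≠ 0 := by
    intro h0
    have := congrArg constantCoeff h0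
    rw [map_ofNat, map_zero] at this
    norm_num at this
  apply mul_left_cancel₀ hne3
  linear_combination hfin

end GeneratingFunction

/-! ### Descent of the identities to integer coefficients. -/

section IntegralIdentities

theorem expand_injective {R : Type*} [CommRing R] (M : ℕ) (hM : M ≠ 0) :
    Function.Injective (expand M hM : R⟦X⟧ → R⟦X⟧) := by
  intro f g h
  ext n
  rw [← coeff_expand_mul M hM f, h, coeff_expand_mul]

/-- Over a field of characteristic zero with a primitive cube root of unity `ω`, the Borwein
identities, with `i` the inverse of Euler's product. -/
theorem borwein_identities_of_cube_root {K : Type*} [CommRing K] [IsDomain K] [CharZero K] {ω : K}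
    (hω : ω ^ 2 + ω + 1 = 0) (i : K⟦X⟧) (hi : eulerSeries K 1 one_ne_zero * i = 1) :
    let V := (expand 3 three_ne_zero : K⟦X⟧ →ₐ[K] K⟦X⟧)
    let e := eulerSeries K 1 one_ne_zero
    let w := V e ^ 3 * i
    let b := e ^ 3 * V i
    let a := b + 9 * (X * V w)
    V a = b + 3 * (X * V w) ∧ V b ^ 3 = V a ^ 3 - 27 * (X * V w) ^ 3 ∧
      e ^ 9 * PowerSeries.mk (fun n => (cphi 9 n : K)) = b ^ 3 * V a + 81 * a * (X * w ^ 3) := by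
  intro V e w b a
  let _ : TopologicalSpace K := ⊥
  have : DiscreteTopology K := ⟨rfl⟩
  have hV : V e = eulerSeries K 3 three_ne_zero := expand_eulerSeries 3 1 three_ne_zero one_ne_zero
  have hVV : V (V e) = eulerSeries K 9 (by norm_num) := by
    rw [hV]; exact expand_eulerSeries 3 3 three_ne_zero three_ne_zero
  have hVi : V e * V i = 1 := by rw [← map_mul, hi, map_one]
  have hVVi : V (V e) * V (V i) = 1 := by rw [← map_mul, hVi, map_one]
  have hVh : ∀ r, V (borweinTheta r X) = borweinTheta r (X ^ 3) := fun r => by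
    have := expand_borweinTheta (R := K) r 3 1 three_ne_zero one_ne_zero
    simpa using this
  have f1 := borweinTheta_neg_one_mul (K := K) hω
  have f2 := eulerSeries_cubed (K := K)
  have f3 := borweinTheta_cubed_sub (K := K) hω
  have f4 := borweinTheta_zero_mul (K := K) hω
  have f5 := mul_genFun_cphi_nine (K := K) hω
  rw [← hVV, ← hVh, ← hVh, ← hV] at f3
  rw [← hVV, ← hV] at f4
  rw [← hV] at f1
  rw [← hVh, ← hVh, ← hV] at f2
  rw [← hVh, ← hV] at f5
  change _ * e = _ at f1
  change e ^ 3 = _ at f2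
  change _ = e ^ 3 + _ at f4
  change _ * e ^ 10 * _ = e ^ 10 * _ + _ at f5
  change e * i = 1 at hi
  have h1 : borweinTheta (-1) X = 3 * w := by
    linear_combination i * f1 - borweinTheta (-1) X * hi
  have hVw : V w = V (V e) ^ 3 * V i := by rw [map_mul, map_pow]
  have h0 : borweinTheta 0 X = a := by
    simp only [a, b, hVw]
    linear_combination V i * f4 - borweinTheta 0 X * hVi
  have hVh1 : V (borweinTheta (-1) X) = 3 * V w := by rw [h1, map_mul, map_ofNat]
  rw [h0, hVh1] at f2 f3
  rw [h0, h1] at f5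
  have hVb : V b = V e ^ 3 * V (V i) := by rw [map_mul, map_pow]
  refine ⟨?_, ?_, ?_⟩
  · linear_combination -V i * f2 + (X * (3 * V w) - V a) * hVi
  · have hcube : (V (V e) * V (V i)) ^ 3 = 1 := by rw [hVVi, one_pow]
    rw [hVb]
    linear_combination -V (V i) ^ 3 * f3 + (V a ^ 3 - X ^ 3 * (3 * V w) ^ 3) * hcube
  · have hcube : (V e * V i) ^ 3 = 1 := by rw [hVi, one_pow]
    set P := PowerSeries.mk fun n => (cphi 9 n : K)
    simp only [b]
    have hw : w ^ 3 = w ^ 2 * (V e ^ 3 * i) := by ring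
    linear_combination V i ^ 3 * i * f5 + (e ^ 9 * V i ^ 3 * V a - e ^ 9 * P * (V e * V i) ^ 3) * hi
      - e ^ 9 * P * hcube + 81 * a * X * w ^ 2 * V e ^ 3 * i * hcube

/-- The cubic theta function parametrization of the generating function of `cphi 9`. -/
theorem exists_integral_parametrization : ∃ e i a a' w : ℤ⟦X⟧,
    let V := (expand 3 three_ne_zero : ℤ⟦X⟧ →ₐ[ℤ] ℤ⟦X⟧)
    let u := X * V w
    e * i = 1 ∧ a * a' = 1 ∧ w = V e ^ 3 * i ∧ V a = a - 6 * u ∧ e ^ 3 * V i = a - 9 * u ∧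
      X * w ^ 3 = u * ((a - 9 * u) ^ 2 + 9 * (a - 9 * u) * u + 27 * u ^ 2) ∧
      e ^ 9 * PowerSeries.mk (fun n => (cphi 9 n : ℤ)) =
        (a - 9 * u) ^ 3 * V a + 81 * a * (X * w ^ 3) := by
  set V := (expand 3 three_ne_zero : ℤ⟦X⟧ →ₐ[ℤ] ℤ⟦X⟧) with hVdef
  set e := eulerSeries ℤ 1 one_ne_zero with he
  have hce : constantCoeff e = 1 := constantCoeff_eulerSeries 1 one_ne_zero
  have hu : IsUnit e := by rw [isUnit_iff_constantCoeff, hce]; exact isUnit_one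
  obtain ⟨i, hi⟩ := hu.exists_right_inv
  set w := V e ^ 3 * i with hw
  set b := e ^ 3 * V i with hb
  set a := b + 9 * (X * V w) with ha
  have hci : constantCoeff i = 1 := by
    have := congrArg constantCoeff hi
    rwa [map_mul, hce, one_mul, map_one] at this
  have hua : IsUnit a := by
    rw [isUnit_iff_constantCoeff, ha, hb]
    simp [hVdef, hce, hci]
  obtain ⟨a', ha'⟩ := hua.exists_right_inv
  -- The identities are proved over ℂ, where ω exists, and pulled back along the injection of ℤ⟦X⟧.
  obtain ⟨ω, hω⟩ : ∃ ω : ℂ, ω ^ 2 + ω + 1 = 0 := by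
    obtain ⟨s, hs⟩ := IsAlgClosed.exists_pow_nat_eq (-3 : ℂ) (n := 2) (by norm_num)
    exact ⟨(s - 1) / 2, by linear_combination hs / 4⟩
  set ι := PowerSeries.map (Int.castRingHom ℂ) with hι
  have hinj : Function.Injective ι := map_injective _ Int.cast_injective
  have hιV : ∀ f, ι (V f) = expand 3 three_ne_zero (ι f) := fun f => map_expand _ _ _ f
  have hιe : ι e = eulerSeries ℂ 1 one_ne_zero := map_eulerSeries _ _ _
  have key := borwein_identities_of_cube_root hω (ι i) (by rw [← hιe, ← map_mul, hi, map_one])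
  have hιP : ι (PowerSeries.mk fun n => (cphi 9 n : ℤ)) = PowerSeries.mk fun n => (cphi 9 n : ℂ) := by
    ext n
    simp [hι]
  have hιX : ι X = X := map_X _
  simp only [← hιe, ← hιV, ← map_mul, ← map_pow, ← hιX, ← hιP, ← map_ofNat ι, ← map_add,
    ← map_sub] at key
  obtain ⟨k1, k2, k3⟩ := key
  replace k1 := hinj k1
  replace k2 := hinj k2
  replace k3 := hinj k3
  simp only [map_pow V] at k1 k2 k3
  rw [← hw, ← hb, ← ha] at k1 k2 k3
  -- The cubic relation is known at q³. Since X³(V w)³ = V(X w³), it is the image under V of a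
  -- relation at q.
  have k2' : b ^ 3 = a ^ 3 - 27 * (X * w ^ 3) := by
    apply expand_injective 3 three_ne_zero
    change V _ = V _
    have hVX : V X = X ^ 3 := expand_X _ _
    rw [map_pow, k2, map_sub, map_mul V 27, map_mul V X (w ^ 3), map_pow, map_pow, hVX, map_ofNat]
    ring
  refine ⟨e, i, a, a', w, hi, ha', hw, ?_, ?_, ?_, ?_⟩
  · rw [k1, ha]; ring
  · rw [ha]; ring
  · have h27 : (27 : ℤ⟦X⟧) ≠ 0 := by
      intro h0
      have := congrArg constantCoeff h0
      rw [map_ofNat, map_zero] at this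
      norm_num at this
    apply mul_left_cancel₀ h27
    have hba : b = a - 9 * (X * V w) := by rw [ha]; ring
    rw [hba] at k2'
    linear_combination k2'
  · have hba : a - 9 * (X * V w) = b := by rw [ha]; ring
    rw [hba]
    exact k3

end IntegralIdentities

/-! ### Polynomial arithmetic on coefficient lists, for evaluation by the kernel. -/

section CoefficientLists

/-- Evaluation of the polynomial with coefficients `l` (constant term first). -/
def evalList {A : Type*} [CommRing A] (x : A) : List ℕ → A
  | [] => 0
  | c :: l => c + x * evalList x l

/-- Addition of coefficient lists modulo `M`. -/
def addList (M : ℕ) : List ℕ → List ℕ → List ℕ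
  | [], l => l
  | a :: k, [] => a :: k
  | a :: k, b :: l => ((a + b) % M) :: addList M k l

/-- Multiplication of a coefficient list by a scalar modulo `M`. -/
def smulList (M c : ℕ) : List ℕ → List ℕ
  | [] => []
  | a :: k => (c * a % M) :: smulList M c k

/-- Multiplication of coefficient lists modulo `M`. -/
def mulList (M : ℕ) : List ℕ → List ℕ → List ℕ
  | [], _ => []
  | a :: k, l => addList M (smulList M a l) (0 :: mulList M k l)

/-- Powers of coefficient lists modulo `M`. -/
def powList (M : ℕ) (l : List ℕ) : ℕ → List ℕ
  | 0 => [1]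
  | n + 1 => mulList M l (powList M l n)

/-- Composition of coefficient lists modulo `M`. -/
def compList (M : ℕ) : List ℕ → List ℕ → List ℕ
  | [], _ => []
  | a :: k, l => addList M [a] (mulList M l (compList M k l))

/-- Equality of coefficient lists modulo `M`, up to trailing zeros. -/
def eqList (M : ℕ) : List ℕ → List ℕ → Bool
  | [], l => l.all fun b => b % M == 0
  | a :: k, l => a % M == l.headD 0 % M && eqList M k l.tail

/-- The entries at the indices divisible by three. -/
def everyThird : List ℕ → List ℕ
  | [] => []
  | [a] => [a]
  | [a, _] => [a]
  | a :: _ :: _ :: l => a :: everyThird l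

variable {A : Type*} [CommRing A] {M : ℕ}

theorem natCast_mod_eq (hM : (M : A) = 0) (a : ℕ) : ((a % M : ℕ) : A) = a := by
  conv_rhs => rw [← Nat.mod_add_div a M]
  simp [hM]

theorem evalList_addList (hM : (M : A) = 0) (x : A) (k l : List ℕ) :
    evalList x (addList M k l) = evalList x k + evalList x l := by
  induction k generalizing l with
  | nil => simp [addList, evalList]
  | cons a k ih =>
    cases l with
    | nil => simp [addList, evalList]
    | cons b l =>
      simp only [addList, evalList, ih, natCast_mod_eq hM]
      push_cast
      ring

theorem evalList_smulList (hM : (M : A) = 0) (x : A) (c : ℕ) (l : List ℕ) :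
    evalList x (smulList M c l) = c * evalList x l := by
  induction l with
  | nil => simp [smulList, evalList]
  | cons a k ih =>
    simp only [smulList, evalList, ih, natCast_mod_eq hM]
    push_cast
    ring

theorem evalList_mulList (hM : (M : A) = 0) (x : A) (k l : List ℕ) :
    evalList x (mulList M k l) = evalList x k * evalList x l := by
  induction k with
  | nil => simp [mulList, evalList]
  | cons a k ih =>
    simp only [mulList, evalList_addList hM, evalList_smulList hM, evalList, ih]
    push_cast
    ring

theorem evalList_powList (hM : (M : A) = 0) (x : A) (l : List ℕ) (n : ℕ) :
    evalList x (powList M l n) = evalList x l ^ n := by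
  induction n with
  | zero => simp [powList, evalList]
  | succ n ih => rw [powList, evalList_mulList hM, ih, pow_succ']

theorem evalList_compList (hM : (M : A) = 0) (x : A) (k l : List ℕ) :
    evalList x (compList M k l) = evalList (evalList x l) k := by
  induction k with
  | nil => simp [compList, evalList]
  | cons a k ih =>
    simp only [compList, evalList_addList hM, evalList_mulList hM, evalList, ih]
    ring

theorem evalList_eq_zero_of_all (hM : (M : A) = 0) (x : A) (l : List ℕ)
    (h : l.all (fun b => b % M == 0) = true) : evalList x l = 0 := by
  induction l with
  | nil => rfl
  | cons b l ih =>
    simp only [List.all_cons, Bool.and_eq_true, beq_iff_eq] at h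
    rw [evalList, ih h.2, ← natCast_mod_eq hM b, h.1]
    simp

theorem evalList_eq_of_eqList (hM : (M : A) = 0) (x : A) (k l : List ℕ)
    (h : eqList M k l = true) : evalList x k = evalList x l := by
  induction k generalizing l with
  | nil => exact (evalList_eq_zero_of_all hM x l h).symm
  | cons a k ih =>
    simp only [eqList, Bool.and_eq_true, beq_iff_eq] at h
    rw [evalList, ih _ h.2, ← natCast_mod_eq hM a, h.1, natCast_mod_eq hM]
    cases l <;> simp [evalList]

theorem dvd_evalList {d : ℕ} (x : A) {l : List ℕ} (h : ∀ a ∈ l, d ∣ a) :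
    (d : A) ∣ evalList x l := by
  induction l with
  | nil => exact dvd_zero _
  | cons a k ih =>
    rw [List.forall_mem_cons] at h
    exact dvd_add (Nat.cast_dvd_cast h.1) (Dvd.dvd.mul_left (ih h.2) _)

end CoefficientLists

/-! ### Trisection of power series. -/

section Trisection

variable {R : Type*} [CommRing R]

/-- The `r`-th trisection `∑ f_{3 n + r} X ^ n` of a power series. -/
noncomputable def trisect (r : ℕ) : R⟦X⟧ →+ R⟦X⟧ where
  toFun f := PowerSeries.mk fun n => coeff (3 * n + r) f
  map_zero' := by ext n; simp
  map_add' f g := by ext n; simp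

theorem coeff_trisect (r n : ℕ) (f : R⟦X⟧) : coeff n (trisect r f) = coeff (3 * n + r) f := by
  simp [trisect]

theorem trisect_X_pow_mul_expand {r k : ℕ} (hr : r < 3) (hk : k < 3) (g : R⟦X⟧) :
    trisect r (X ^ k * expand 3 three_ne_zero g) = if k = r then g else 0 := by
  ext n
  rw [coeff_trisect, coeff_X_pow_mul', coeff_expand]
  by_cases hkr : k = r
  · subst hkr
    have h1 : k ≤ 3 * n + k := Nat.le_add_left _ _
    simp [h1]
  · rw [if_neg hkr, map_zero]
    split_ifs with h1 h2
    · exact absurd h2 (by omega)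
    · rfl
    · rfl

/-- For s = X V(τ) one has s^(3n+r) = X^r V(τ^r (Xτ³)^n), so only exponents congruent to r survive.
The recursion takes three coefficients at a time, moving s³ = V(Xτ³) into the prefactor. -/
theorem trisect_evalList {r : ℕ} (hr : r < 3) (c τ : R⟦X⟧) :
    ∀ l : List ℕ, trisect r (expand 3 three_ne_zero c *
      evalList (X * expand 3 three_ne_zero τ) l) =
      c * τ ^ r * evalList (X * τ ^ 3) (everyThird (l.drop r))
  | [] => by simp [evalList, everyThird]
  | [a] => by
    have h := trisect_X_pow_mul_expand hr (k := 0) (by norm_num) (c * (a : R⟦X⟧))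
    have e : expand 3 three_ne_zero c * evalList (X * expand 3 three_ne_zero τ) [a] =
        X ^ 0 * expand 3 three_ne_zero (c * (a : R⟦X⟧)) := by
      rw [map_mul, map_natCast]
      simp only [evalList]
      ring
    rw [e, h]
    interval_cases r <;> simp [evalList, everyThird]
  | [a, b] => by
    have h0 := trisect_X_pow_mul_expand hr (k := 0) (by norm_num) (c * (a : R⟦X⟧))
    have h1 := trisect_X_pow_mul_expand hr (k := 1) (by norm_num) (c * τ * (b : R⟦X⟧))
    have e : expand 3 three_ne_zero c * evalList (X * expand 3 three_ne_zero τ) [a, b] =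
        X ^ 0 * expand 3 three_ne_zero (c * (a : R⟦X⟧)) + X ^ 1 * expand 3 three_ne_zero (c * τ * (b : R⟦X⟧)) := by
      rw [map_mul, map_natCast, map_mul, map_natCast, map_mul]
      simp only [evalList]
      ring
    rw [e, map_add, h0, h1]
    interval_cases r <;> simp [evalList, everyThird]
  | a :: b :: d :: l => by
    have h0 := trisect_X_pow_mul_expand hr (k := 0) (by norm_num) (c * (a : R⟦X⟧))
    have h1 := trisect_X_pow_mul_expand hr (k := 1) (by norm_num) (c * τ * (b : R⟦X⟧))
    have h2 := trisect_X_pow_mul_expand hr (k := 2) (by norm_num) (c * τ ^ 2 * (d : R⟦X⟧))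
    have h3 := trisect_evalList hr (X * c * τ ^ 3) τ l
    have e : expand 3 three_ne_zero c * evalList (X * expand 3 three_ne_zero τ) (a :: b :: d :: l) =
        X ^ 0 * expand 3 three_ne_zero (c * (a : R⟦X⟧)) + X ^ 1 * expand 3 three_ne_zero (c * τ * (b : R⟦X⟧)) +
        X ^ 2 * expand 3 three_ne_zero (c * τ ^ 2 * (d : R⟦X⟧)) + expand 3 three_ne_zero (X * c * τ ^ 3) *
          evalList (X * expand 3 three_ne_zero τ) l := by
      simp only [map_mul, map_natCast, map_pow, expand_X, evalList]
      ring
    rw [e, map_add, map_add, map_add, h0, h1, h2, h3]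
    have hd : ∀ r, r < 3 → ∃ k, (a :: b :: d :: l).drop r = k ∧
      everyThird k = (if r = 0 then a else if r = 1 then b else d) :: everyThird (l.drop r) := by
      intro r hr
      refine ⟨_, rfl, ?_⟩
      interval_cases r
      · simp [everyThird]
      · rcases l with _ | ⟨x, l⟩ <;> simp [everyThird]
      · rcases l with _ | ⟨x, _ | ⟨y, l⟩⟩ <;> simp [everyThird]
    obtain ⟨k, hk, hk'⟩ := hd r hr
    rw [hk, hk', evalList]
    interval_cases r <;> simp <;> ring

end Trisection

/-! ### The trisection chain modulo 3^14. -/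

section Chain

/-- The modulus `3 ^ 14`. -/
abbrev modulus : ℕ := 4782969

/-- The coefficients of `(1 - 3 s)⁻¹`. -/
def invOneSubThree : List ℕ := [1, 3, 9, 27, 81, 243, 729, 2187, 6561, 19683, 59049, 177147, 531441,
  1594323]

/-- The coefficients of `(1 + 6 s)⁻¹`. -/
def invOneAddSix : List ℕ := [1, 4782963, 36, 4782753, 1296, 4775193, 46656, 4503033, 1679616,
  4271211, 3070548, 708588, 531441, 1594323]

/-- The coefficients of `s (1 + 3 s + 9 s ^ 2) / (1 + 6 s) ^ 3`. -/
def sigmaList : List ℕ := mulList modulus [0, 1, 3, 9] (powList modulus invOneAddSix 3)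

/-- The coefficients of `((1 - 3 s) ^ 3 + 81 s (1 + 6 s) (1 + 3 s + 9 s ^ 2)) / (1 - 3 s) ^ 3`. -/
def initialList : List ℕ := mulList modulus
  (addList modulus (powList modulus [1, 4782966] 3) (mulList modulus [0, 81, 486] [1, 3, 9]))
  (powList modulus invOneSubThree 3)

/-- Trisection, change of variable, and multiplication by a prefactor. -/
def chainStep (pre : List ℕ) (r : ℕ) (l : List ℕ) : List ℕ :=
  mulList modulus pre (compList modulus (everyThird (l.drop r)) sigmaList)

variable {R : Type*} [CommRing R]

/-- The modular equation `hσ` turns the polynomial in Xτ³ back into one in s, and `hc` does the same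
for the prefactor, so the step can be iterated. -/
theorem trisect_eq_chainStep (hM : (modulus : R⟦X⟧) = 0) {f c c' τ s p : R⟦X⟧} {l l' pre : List ℕ}
    {r : ℕ} (hr : r < 3) (hs : s = X * expand 3 three_ne_zero τ)
    (hσ : X * τ ^ 3 = evalList s sigmaList) (hf : f = expand 3 three_ne_zero c * evalList s l)
    (hpre : evalList s pre = p) (hc : c * τ ^ r = expand 3 three_ne_zero c' * p)
    (hl : eqList modulus (chainStep pre r l) l' = true) :
    trisect r f = expand 3 three_ne_zero c' * evalList s l' := by
  rw [hf, ← evalList_eq_of_eqList hM s _ _ hl, chainStep, evalList_mulList hM,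
    evalList_compList hM, ← hσ, ← mul_assoc, hpre, ← hc, hs]
  exact trisect_evalList hr c τ l

theorem dvd_trisect {f c τ s : R⟦X⟧} {l : List ℕ} {r d : ℕ} (hr : r < 3)
    (hs : s = X * expand 3 three_ne_zero τ) (hf : f = expand 3 three_ne_zero c * evalList s l)
    (hd : ∀ a ∈ everyThird (l.drop r), d ∣ a) : (d : R⟦X⟧) ∣ trisect r f := by
  rw [hf, hs, trisect_evalList hr]
  exact Dvd.dvd.mul_left (dvd_evalList _ hd) _

end Chain

/-! ### Extraction of the ten congruences. -/

theorem trisect_dvd_conclusion {f : (ZMod modulus)⟦X⟧} {m : ℕ → ℕ} {e : ℕ} (he : e ≤ 14)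
    (hf : ((3 ^ e : ℕ) : (ZMod modulus)⟦X⟧) ∣ f)
    (hm : ∀ n, coeff n f = (cphi 9 (m n) : ZMod modulus)) (n : ℕ) :
    cphi 9 (m n) ≡ 0 [MOD 3 ^ e] := by
  obtain ⟨g, rfl⟩ := hf
  have h := hm n
  rw [← map_natCast (C : ZMod modulus →+* (ZMod modulus)⟦X⟧), coeff_C_mul] at h
  have hdvd : 3 ^ e ∣ modulus := by
    rw [show modulus = 3 ^ 14 by norm_num]
    exact pow_dvd_pow _ he
  have h2 := congrArg (ZMod.castHom hdvd (ZMod (3 ^ e))) h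
  rw [map_mul, map_natCast, map_natCast, ZMod.natCast_self, zero_mul] at h2
  exact (Nat.modEq_zero_iff_dvd.2 ((ZMod.natCast_eq_zero_iff _ _).1 h2.symm))

theorem theorem3 (n : ℕ) :
    cphi 9 (9 * n + 3) ≡ 0 [MOD 3 ^ 2] ∧
    cphi 9 (9 * n + 6) ≡ 0 [MOD 3 ^ 3] ∧
    cphi 9 (27 * n + 15) ≡ 0 [MOD 3 ^ 5] ∧
    cphi 9 (27 * n + 24) ≡ 0 [MOD 3 ^ 7] ∧
    cphi 9 (81 * n + 51) ≡ 0 [MOD 3 ^ 8] ∧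
    cphi 9 (81 * n + 78) ≡ 0 [MOD 3 ^ 9] ∧
    cphi 9 (243 * n + 132) ≡ 0 [MOD 3 ^ 10] ∧
    cphi 9 (243 * n + 213) ≡ 0 [MOD 3 ^ 12] ∧
    cphi 9 (729 * n + 456) ≡ 0 [MOD 3 ^ 13] ∧
    cphi 9 (729 * n + 699) ≡ 0 [MOD 3 ^ 14] := by
  obtain ⟨e₀, i₀, a₀, a'₀, w₀, h⟩ := exists_integral_parametrization
  -- No congruence exceeds 3^14, and modulo 3^14 the geometric series for 1 - 3s and 1 + 6s stop
  -- after 14 terms.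
  set ι := PowerSeries.map (Int.castRingHom (ZMod modulus)) with hι
  have hιV : ∀ f, ι (expand 3 three_ne_zero f) = expand 3 three_ne_zero (ι f) :=
    fun f => map_expand _ _ _ f
  have hιX : ι X = X := map_X _
  have hιP : ι (PowerSeries.mk fun n => (cphi 9 n : ℤ)) =
      PowerSeries.mk fun n => (cphi 9 n : ZMod modulus) := by
    ext n
    simp [hι]
  obtain ⟨hei, haa, hw, hVa, hb, hv, hP⟩ := h
  replace hei := congrArg ι hei
  replace haa := congrArg ι haa
  replace hw := congrArg ι hw
  replace hVa := congrArg ι hVa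
  replace hb := congrArg ι hb
  replace hv := congrArg ι hv
  replace hP := congrArg ι hP
  simp only [map_mul, map_add, map_sub, map_pow, map_one, map_ofNat, hιV, hιX, hιP]
    at hei haa hw hVa hb hv hP
  generalize ι e₀ = e at *
  generalize ι i₀ = i at *
  generalize ι a₀ = a at *
  generalize ι a'₀ = a' at *
  generalize ι w₀ = w at *
  clear hιV hιX hιP
  set V := (expand 3 three_ne_zero : (ZMod modulus)⟦X⟧ →ₐ[ZMod modulus] (ZMod modulus)⟦X⟧) with hV
  set Φ := PowerSeries.mk fun n => (cphi 9 n : ZMod modulus) with hΦ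
  have hVei : V e * V i = 1 := by rw [← map_mul, hei, map_one]
  have hVaa : V a * V a' = 1 := by rw [← map_mul, haa, map_one]
  have hM : (modulus : (ZMod modulus)⟦X⟧) = 0 := by
    rw [← map_natCast (C : ZMod modulus →+* (ZMod modulus)⟦X⟧), ZMod.natCast_self, map_zero]
  set τ := w * a' with hτ
  set s := X * V τ with hs
  have hVw : X * V w = V a * s := by
    rw [hs, hτ, map_mul]
    linear_combination -X * V w * hVaa
  rw [hVw] at hVa hb hv hP
  -- These relations write a, b = e³ V i and X w³ as an expanded series times a polynomial in s.
  -- They are all that is needed to rewrite the prefactors.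
  have ha : a = V a * (1 + 6 * s) := by linear_combination -hVa
  have hb' : e ^ 3 * V i = V a * (1 - 3 * s) := by linear_combination hb + ha
  have hv' : X * w ^ 3 = V a ^ 3 * (s * (1 + 3 * s + 9 * s ^ 2)) := by
    rw [hv]
    linear_combination (V a * s * (a + V a * (1 + 6 * s) - 9 * V a * s)) * ha
  -- inverses of `1 - 3 s` and `1 + 6 s`
  set m := evalList s invOneSubThree with hm
  set k := evalList s invOneAddSix with hk
  have hmul : ∀ l l' p : List ℕ, eqList modulus (mulList modulus l l') p = true →
      evalList s l * evalList s l' = evalList s p := fun l l' p h => by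
    rw [← evalList_mulList hM, evalList_eq_of_eqList hM s _ _ h]
  have hmod : (4782969 : (ZMod modulus)⟦X⟧) = 0 := by exact_mod_cast hM
  have e3 : evalList s [1, 4782966] = 1 - 3 * s := by
    simp only [evalList]
    push_cast
    linear_combination s * hmod
  have e6 : evalList s [1, 6] = 1 + 6 * s := by
    simp only [evalList]
    push_cast
    ring
  have hm1 : (1 - 3 * s) * m = 1 := by
    rw [← e3, hm, hmul _ _ [1] (by decide +kernel)]
    simp [evalList]
  have hk1 : (1 + 6 * s) * k = 1 := by
    rw [← e6, hk, hmul _ _ [1] (by decide +kernel)]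
    simp [evalList]
  have hak : a' = V a' * k := by
    linear_combination V a' * k * haa - a' * V a' * k * ha - a' * V a * V a' * hk1
      - a' * hVaa
  have hσ : X * τ ^ 3 = evalList s sigmaList := by
    rw [sigmaList, evalList_mulList hM, evalList_powList hM, ← hk]
    have e13 : evalList s [0, 1, 3, 9] = s * (1 + 3 * s + 9 * s ^ 2) := by
      simp only [evalList]
      push_cast
      ring
    have h3 : X * τ ^ 3 = X * w ^ 3 * V a' ^ 3 * k ^ 3 := by
      rw [show τ = w * (V a' * k) by rw [hτ, ← hak]]
      ring
    rw [h3, hv', e13]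
    have h4 : V a ^ 3 * V a' ^ 3 = 1 := by rw [← mul_pow, hVaa, one_pow]
    linear_combination (s * (1 + 3 * s + 9 * s ^ 2)) * k ^ 3 * h4
  have hei' : e ^ 3 * i ^ 3 = 1 := by rw [← mul_pow, hei, one_pow]
  have hi3 : i ^ 3 = V i * V a' * m := by
    have h1 : i ^ 3 * V a * (1 - 3 * s) = V i := by
      linear_combination V i * hei' - i ^ 3 * hb'
    linear_combination V a' * m * h1 - i ^ 3 * V a * V a' * hm1 - i ^ 3 * hVaa
  have he3 : e ^ 3 = V e * V a * (1 - 3 * s) := by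
    linear_combination V e * hb' - e ^ 3 * hVei
  have hei9 : e ^ 9 * i ^ 9 = 1 := by rw [← mul_pow, hei, one_pow]
  have hΦ0 : Φ = V (i ^ 3 * a) * evalList s
      [1, 81, 1458, 13122, 85293, 452709, 2125764, 4428675, 4251528] := by
    rw [← evalList_eq_of_eqList hM s initialList _ (by decide +kernel), initialList]
    simp only [evalList_mulList hM, evalList_addList hM, evalList_powList hM, e3, ← hm]
    have e8 : evalList s [0, 81, 486] * evalList s [1, 3, 9] =
        81 * s * (1 + 6 * s) * (1 + 3 * s + 9 * s ^ 2) := by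
      simp only [evalList]
      push_cast
      ring
    have hi9 : i ^ 9 = V i ^ 3 * V a' ^ 3 * m ^ 3 := by
      rw [show i ^ 9 = (i ^ 3) ^ 3 by ring, hi3]
      ring
    have h1 : e ^ 9 * Φ = V a ^ 4 * ((1 - 3 * s) ^ 3 +
        81 * s * (1 + 6 * s) * (1 + 3 * s + 9 * s ^ 2)) := by
      rw [hP, hv', show a - 9 * (V a * s) = V a * (1 - 3 * s) by linear_combination ha]
      linear_combination (81 * V a ^ 3 * (s * (1 + 3 * s + 9 * s ^ 2))) * ha
    have h4 : V a ^ 3 * V a' ^ 3 = 1 := by rw [← mul_pow, hVaa, one_pow]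
    rw [e8, map_mul, map_pow]
    generalize (1 - 3 * s) ^ 3 + 81 * s * (1 + 6 * s) * (1 + 3 * s + 9 * s ^ 2) = H at *
    linear_combination i ^ 9 * h1 - Φ * hei9 + V a ^ 4 * H * hi9
      + V i ^ 3 * V a * m ^ 3 * H * h4
  have hτk : τ = V e ^ 3 * i * V a' * k := by
    linear_combination hτ + a' * hw + V e ^ 3 * i * hak
  have ha3 : a' ^ 3 = V a' ^ 3 * k ^ 3 := by rw [← mul_pow, ← hak]
  have ha4 : a' ^ 4 = V a' ^ 4 * k ^ 4 := by rw [← mul_pow, ← hak]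
  -- Used twice, for 9n+6 → 27n+24 and for 81n+51 → 243n+213, where the prefactor before the step is
  -- the same.
  have hstep : e ^ 5 * a' ^ 3 * τ ^ 2 =
      V e ^ 7 * V a' ^ 4 * ((1 - 3 * s) * evalList s invOneAddSix ^ 5) := by
    have h1 : e ^ 5 * i ^ 2 = V e * V a * (1 - 3 * s) := by
      rw [← he3]
      linear_combination e ^ 3 * (e * i + 1) * hei
    rw [ha3, hτk, ← hk]
    linear_combination V a' ^ 5 * k ^ 5 * V e ^ 6 * h1
      + V e ^ 7 * V a' ^ 4 * k ^ 5 * (1 - 3 * s) * hVaa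
  -- Only powers of e³ convert into expanded series. Since τ contains i once, the branch r is
  -- followed where the exponent of e in c τ^r is a multiple of 3: i³, i·i², e⁵i², e⁷i, e⁵i² along
  -- the chain.
  have hF1 : trisect 0 Φ = V i * evalList s [1, 13131, 2047059, 4015413, 3543183, 2657934,
      3190833, 6561, 19683, 59049, 177147, 531441, 1594323] := by
    refine trisect_eq_chainStep hM (by norm_num) hs hσ hΦ0
      (pre := mulList modulus [1, 6] invOneSubThree) (evalList_mulList hM _ _ _) ?_
      (by decide +kernel)
    rw [e6, ← hm, pow_zero, mul_one, hi3]
    linear_combination V i * V a' * m * ha + V i * m * (1 + 6 * s) * hVaa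
  have hF2 : trisect 2 (trisect 0 Φ) = V (e ^ 5 * a' ^ 3) * evalList s [2047059, 3366279, 1598697,
      1092042, 164025, 826686, 3857868, 2657205, 0, 531441] := by
    refine trisect_eq_chainStep hM (by norm_num) hs hσ hF1
      (pre := mulList modulus invOneSubThree (powList modulus invOneAddSix 2))
      (by rw [evalList_mulList hM, evalList_powList hM]) ?_ (by decide +kernel)
    rw [← hm, ← hk, map_mul, map_pow, map_pow, hτk]
    linear_combination V e ^ 6 * V a' ^ 2 * k ^ 2 * hi3 + V e ^ 5 * V a' ^ 3 * m * k ^ 2 * hVei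
  have hF3 : trisect 2 (trisect 2 (trisect 0 Φ)) = V (e ^ 7 * a' ^ 4) *
      evalList s [1598697, 682344, 1338444, 2893401, 177147, 531441] := by
    refine trisect_eq_chainStep hM (by norm_num) hs hσ hF2
      (pre := mulList modulus [1, 4782966] (powList modulus invOneAddSix 5))
      (by rw [evalList_mulList hM, evalList_powList hM]) ?_ (by decide +kernel)
    rw [e3, map_mul, map_pow, map_pow, hstep]
  have hF4 : trisect 1 (trisect 2 (trisect 2 (trisect 0 Φ))) = V (e ^ 5 * a' ^ 3) *
      evalList s [682344, 4310577, 531441, 354294, 3188646] := by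
    refine trisect_eq_chainStep hM (by norm_num) hs hσ hF3
      (pre := mulList modulus (powList modulus [1, 4782966] 2) (powList modulus invOneAddSix 5))
      (by rw [evalList_mulList hM, evalList_powList hM, evalList_powList hM]) ?_
      (by decide +kernel)
    rw [e3, ← hk, map_mul, map_pow, map_pow, ha4, hτk]
    have h1 : e ^ 7 * i = (V e * V a * (1 - 3 * s)) ^ 2 := by
      rw [← he3]
      linear_combination e ^ 6 * hei
    linear_combination V a' ^ 5 * k ^ 5 * V e ^ 3 * h1
      + V e ^ 5 * V a' ^ 3 * k ^ 5 * (1 - 3 * s) ^ 2 * (V a * V a' + 1) * hVaa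
  -- The remaining coefficients are 3^12 and 3^13.
  have hF5 : trisect 2 (trisect 1 (trisect 2 (trisect 2 (trisect 0 Φ)))) = V (e ^ 7 * a' ^ 4) *
      evalList s [531441, 1594323] := by
    refine trisect_eq_chainStep hM (by norm_num) hs hσ hF4
      (pre := mulList modulus [1, 4782966] (powList modulus invOneAddSix 5))
      (by rw [evalList_mulList hM, evalList_powList hM]) ?_ (by decide +kernel)
    rw [e3, map_mul, map_pow, map_pow, hstep]
  have hcoeff : ∀ n, coeff n Φ = (cphi 9 n : ZMod modulus) := fun n => coeff_mk _ _
  refine ⟨?_, ?_, ?_, ?_, ?_, ?_, ?_, ?_, ?_, ?_⟩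
  · refine trisect_dvd_conclusion (m := fun n => 9 * n + 3) (by norm_num)
      (dvd_trisect (r := 1) (by norm_num) hs hF1 (by decide +kernel)) (fun n => ?_) n
    simp only [coeff_trisect, hcoeff]
    ring_nf
  · refine trisect_dvd_conclusion (m := fun n => 9 * n + 6) (by norm_num)
      (dvd_trisect (r := 2) (by norm_num) hs hF1 (by decide +kernel)) (fun n => ?_) n
    simp only [coeff_trisect, hcoeff]
    ring_nf
  · refine trisect_dvd_conclusion (m := fun n => 27 * n + 15) (by norm_num)
      (dvd_trisect (r := 1) (by norm_num) hs hF2 (by decide +kernel)) (fun n => ?_) n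
    simp only [coeff_trisect, hcoeff]
    ring_nf
  · refine trisect_dvd_conclusion (m := fun n => 27 * n + 24) (by norm_num)
      (dvd_trisect (r := 2) (by norm_num) hs hF2 (by decide +kernel)) (fun n => ?_) n
    simp only [coeff_trisect, hcoeff]
    ring_nf
  · refine trisect_dvd_conclusion (m := fun n => 81 * n + 51) (by norm_num)
      (dvd_trisect (r := 1) (by norm_num) hs hF3 (by decide +kernel)) (fun n => ?_) n
    simp only [coeff_trisect, hcoeff]
    ring_nf
  · refine trisect_dvd_conclusion (m := fun n => 81 * n + 78) (by norm_num)
      (dvd_trisect (r := 2) (by norm_num) hs hF3 (by decide +kernel)) (fun n => ?_) n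
    simp only [coeff_trisect, hcoeff]
    ring_nf
  · refine trisect_dvd_conclusion (m := fun n => 243 * n + 132) (by norm_num)
      (dvd_trisect (r := 1) (by norm_num) hs hF4 (by decide +kernel)) (fun n => ?_) n
    simp only [coeff_trisect, hcoeff]
    ring_nf
  · refine trisect_dvd_conclusion (m := fun n => 243 * n + 213) (by norm_num)
      (dvd_trisect (r := 2) (by norm_num) hs hF4 (by decide +kernel)) (fun n => ?_) n
    simp only [coeff_trisect, hcoeff]
    ring_nf
  · refine trisect_dvd_conclusion (m := fun n => 729 * n + 456) (by norm_num)
      (dvd_trisect (r := 1) (by norm_num) hs hF5 (by decide +kernel)) (fun n => ?_) n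
    simp only [coeff_trisect, hcoeff]
    ring_nf
  · refine trisect_dvd_conclusion (m := fun n => 729 * n + 699) (by norm_num)
      -- The list for 243n+213 has no entry at index 2, so the trisection vanishes modulo 3^14.
      (dvd_trisect (r := 2) (by norm_num) hs hF5 (by decide +kernel)) (fun n => ?_) n
    simp only [coeff_trisect, hcoeff]
    ring_nf
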